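/- Let $p$ be a prime, $k$ a perfect field of characteristic $p$, $W=W(k)$, and let $K$ be a finite totally ramified extension of $\mathrm{Frac}(W)$ with ring of integers $\mathcal{O}_K$ (so its residue field is $k$), ramification index $e$ and a uniformizer $\pi$ with Eisenstein (minimal) polynomial $E=E(z)$ over $W$. Let $\mathfrak{S}=W[[z]]$, with the Frobenius $\varphi$ that extends the Frobenius of $W$ and satisfies $\varphi(z)=z^p$. A Breuil--Kisin module is a finitely generated $\mathfrak{S}$-module $\mathfrak{M}$ together with an $\mathfrak{S}[1/E]$-linear isomorphism $\Phi:(\varphi^*\mathfrak{M})[1/E]\xrightarrow{\sim}\mathfrak{M}[1/E]$, where $\varphi^*\mathfrak{M}=\mathfrak{M}\otimes_{\mathfrak{S},\varphi}\mathfrak{S}$; morphisms are the $\mathfrak{S}$-linear maps compatible with $\Phi$. It has $E$-height in $[0,n]$ if $E^n\mathfrak{M}\subset \Phi(\varphi^*\mathfrak{M})\subset\mathfrak{M}$ inside $\mathfrak{M}[1/E]$ (where $\mathfrak{M}$ and $\varphi^*\mathfrak{M}$ stand for their images in the localizations), and finite height if this holds for some $n>0$. Let $r\ge 0$ be an integer.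 Let $\overline{\mathrm{Mod}}^{r,\varphi}_{/\mathfrak{S}_1}$ be the full subcategory of Breuil--Kisin modules of $E$-height in $[0,r]$ whose underlying $\mathfrak{S}$-module is finite free over $\mathfrak{S}/p$ or finite free over $\mathfrak{S}$. Let $\overline{\mathrm{Mod}}^{r,\varphi}_{/\mathfrak{S}_\infty}$ be the smallest full subcategory of the category of Breuil--Kisin modules of finite height that contains $\overline{\mathrm{Mod}}^{r,\varphi}_{/\mathfrak{S}_1}$ and is stable under extensions (short exact sequences being those that are exact on underlying $\mathfrak{S}$-modules). Let $\overline{\mathrm{ModFI}}^{r,\varphi}_{/\mathfrak{S}_\infty}$ be its full subcategory of those objects whose underlying $\mathfrak{S}$-module is isomorphic to $\mathfrak{S}^{\oplus m}\oplus\bigoplus_{i=1}^n\mathfrak{S}/p^{a_i}$ for some integers $m,n\ge 0$ and $a_i\ge 1$. Assume $er<p-1$. Then $$\overline{\mathrm{ModFI}}^{r,\varphi}_{/\mathfrak{S}_\infty}=\overline{\mathrm{Mod}}^{r,\varphi}_{/\mathfrak{S}_\infty}.$$ In particular, every object $M$ of $\overline{\mathrm{Mod}}^{r,\varphi}_{/\mathfrak{S}_\infty}$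 has underlying $\mathfrak{S}$-module of the form $M\simeq\mathfrak{S}^{\oplus m}\oplus\bigoplus_{i=1}^n\mathfrak{S}/p^{a_i}$ with $m,n\ge 0$ and $a_i\ge 1$. -/

import Mathlib

open scoped TensorProduct PowerSeries

universe u v w

noncomputable section

namespace BK

/-! ### Pullback of modules along a ring endomorphism -/

section Pullback

variable {R : Type u} [CommRing R]

/-- The ring `R`, regarded as an `R`-algebra through the endomorphism `σ`. -/
def Twist (_σ : R →+* R) : Type u := R

instance (σ : R →+* R) : CommRing (Twist σ) := inferInstanceAs (CommRing R)

instance (σ : R →+* R) : Algebra R (Twist σ) := RingHom.toAlgebra (S := Twist σ) σ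

/-- The pullback `σ^*M = R ⊗_{σ, R} M` of an `R`-module `M`; in it
`1 ⊗ (a • m) = σ a • (1 ⊗ m)`. -/
def Pullback (σ : R →+* R) (M : Type v) [AddCommGroup M] [Module R M] : Type (max u v) :=
  Twist σ ⊗[R] M

variable (σ : R →+* R) (M : Type v) [AddCommGroup M] [Module R M]

instance : AddCommGroup (Pullback σ M) := inferInstanceAs (AddCommGroup (Twist σ ⊗[R] M))

/-- `R` acts on `R ⊗_{σ, R} M` through multiplication on the left factor `R`. -/
instance : Module R (Pullback σ M) := inferInstanceAs (Module (Twist σ) (Twist σ ⊗[R] M))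

variable {M} {N : Type w} [AddCommGroup N] [Module R N]

/-- The map `σ^*f : σ^*M → σ^*N`, `b ⊗ m ↦ b ⊗ f m`. -/
def Pullback.map (f : M →ₗ[R] N) : Pullback σ M →ₗ[R] Pullback σ N :=
  (LinearMap.baseChange (Twist σ) f : Twist σ ⊗[R] M →ₗ[Twist σ] Twist σ ⊗[R] N)

end Pullback

/-! ### The ring `𝔖 = W(k)⟦z⟧` -/

section Ring

variable (p : ℕ) [Fact p.Prime] (k : Type u) [Field k] [CharP k p]

/-- The ring `𝔖 = W(k)⟦z⟧`. -/
abbrev 𝔖 : Type u := PowerSeries (WittVector p k)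

/-- The Frobenius `∑ aₙ zⁿ ↦ ∑ F(aₙ) z^{pn}` of `𝔖`, where `F` is the Frobenius of `W(k)`. -/
def frob : 𝔖 p k →+* 𝔖 p k :=
  ((PowerSeries.expand p (Fact.out : p.Prime).ne_zero :
      (WittVector p k)⟦X⟧ →ₐ[WittVector p k] (WittVector p k)⟦X⟧) : 𝔖 p k →+* 𝔖 p k).comp
    (PowerSeries.map WittVector.frobenius)

/-- The Eisenstein polynomial over `W(k)` of an element `π` (in practice a uniformizer)
of a `W(k)`-algebra, as an element of `𝔖`. -/
def eisenstein {O : Type v} [CommRing O] [Algebra (WittVector p k) O] (π : O) : 𝔖 p k :=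
  (minpoly (WittVector p k) π : (WittVector p k)⟦X⟧)

end Ring

/-! ### Breuil--Kisin modules -/

variable {p : ℕ} [Fact p.Prime] {k : Type u} [Field k] [CharP k p]

/-- `M[1/E]` for an `𝔖`-module `M`. -/
abbrev Inv (E : 𝔖 p k) (M : Type w) [AddCommGroup M] [Module (𝔖 p k) M] : Type (max u w) :=
  LocalizedModule (Submonoid.powers E) M

/-- The map `f[1/E] : M[1/E] → N[1/E]` induced by an `𝔖`-linear map `f : M → N`. -/
abbrev Inv.map (E : 𝔖 p k) {M : Type v} {N : Type w} [AddCommGroup M] [Module (𝔖 p k) M]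
    [AddCommGroup N] [Module (𝔖 p k) N] (f : M →ₗ[𝔖 p k] N) : Inv E M →ₗ[𝔖 p k] Inv E N :=
  IsLocalizedModule.map (Submonoid.powers E)
    (LocalizedModule.mkLinearMap (Submonoid.powers E) M)
    (LocalizedModule.mkLinearMap (Submonoid.powers E) N) f

/-- A Breuil--Kisin module: a finitely generated `𝔖`-module `M` with an isomorphism
`Φ : (φ^*M)[1/E] ≃ M[1/E]` (an `𝔖`-linear map between `𝔖[1/E]`-modules is
automatically `𝔖[1/E]`-linear). -/
structure BKModule (E : 𝔖 p k) where
  /-- the underlying `𝔖`-module -/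
  carrier : Type w
  [addCommGroup : AddCommGroup carrier]
  [module : Module (𝔖 p k) carrier]
  [finite : Module.Finite (𝔖 p k) carrier]
  /-- the Frobenius structure -/
  Φ : Inv E (Pullback (frob p k) carrier) ≃ₗ[𝔖 p k] Inv E carrier

attribute [instance] BKModule.addCommGroup BKModule.module BKModule.finite

namespace BKModule

variable {E : 𝔖 p k}

/-- A morphism of Breuil--Kisin modules: an `𝔖`-linear map that commutes with `Φ`. -/
structure Hom (M : BKModule.{u, v} E) (N : BKModule.{u, w} E) where
  /-- the underlying `𝔖`-linear map -/
  toLinearMap : M.carrier →ₗ[𝔖 p k] N.carrier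
  comm : ∀ x : Inv E (Pullback (frob p k) M.carrier),
    N.Φ (Inv.map E (Pullback.map (frob p k) toLinearMap) x) = Inv.map E toLinearMap (M.Φ x)

/-- The image of `Φ : φ^*M → M[1/E]`. -/
def image (M : BKModule.{u, w} E) : Submodule (𝔖 p k) (Inv E M.carrier) :=
  LinearMap.range (M.Φ.toLinearMap ∘ₗ
    LocalizedModule.mkLinearMap (Submonoid.powers E) (Pullback (frob p k) M.carrier))

/-- `E^n M` inside `M[1/E]`, that is, the set of all `E^n • (m / 1)`. -/
def lattice (M : BKModule.{u, w} E) (n : ℕ) : Submodule (𝔖 p k) (Inv E M.carrier) :=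
  LinearMap.range (E ^ n • LocalizedModule.mkLinearMap (Submonoid.powers E) M.carrier)

/-- The `E`-height of `M` is contained in `[s, r]`: `E^r M ⊆ im Φ ⊆ E^s M` in `M[1/E]`. -/
def HeightIn (s r : ℕ) (M : BKModule.{u, w} E) : Prop :=
  M.lattice r ≤ M.image ∧ M.image ≤ M.lattice s

/-- The underlying `𝔖`-module is finite free over `𝔖/p`. -/
def FreeModP (M : BKModule.{u, w} E) : Prop :=
  ∃ n : ℕ, Nonempty (M.carrier ≃ₗ[𝔖 p k] (Fin n → 𝔖 p k ⧸ Ideal.span {(p : 𝔖 p k)}))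

/-- The underlying `𝔖`-module is finite free over `𝔖`. -/
def Free (M : BKModule.{u, w} E) : Prop :=
  ∃ n : ℕ, Nonempty (M.carrier ≃ₗ[𝔖 p k] (Fin n → 𝔖 p k))

/-! Full subcategories are given by their classes of objects. -/

/-- Breuil--Kisin modules of `E`-height in `[0, r]`. -/
def ModHeight (r : ℕ) (M : BKModule.{u, w} E) : Prop := HeightIn 0 r M

/-- Breuil--Kisin modules of `E`-height in `[0, n]` for some `n > 0`. -/
def ModHeightInfty (M : BKModule.{u, w} E) : Prop := ∃ n : ℕ, 0 < n ∧ ModHeight n M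

/-- Breuil--Kisin modules of `E`-height in `[0, r]` that are finite free over `𝔖/p` or
finite free over `𝔖`. -/
def ModBarOne (r : ℕ) (M : BKModule.{u, w} E) : Prop :=
  ModHeight r M ∧ (FreeModP M ∨ Free M)

/-- The smallest class of Breuil--Kisin modules of finite `E`-height that contains `ModBarOne r`
and is stable under extensions: if `0 → A → B → C → 0` is a sequence of Breuil--Kisin modules
of finite height, exact on underlying `𝔖`-modules, and `A` and `C` are in the class, so is `B`. -/
inductive ModBarInfty (r : ℕ) : BKModule.{u, w} E → Prop
  | base (M : BKModule.{u, w} E) (hM : ModBarOne r M) : ModBarInfty r M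
  | ext (A B C : BKModule.{u, w} E)
      (hA : ModHeightInfty A) (hB : ModHeightInfty B) (hC : ModHeightInfty C)
      (f : Hom A B) (g : Hom B C)
      (hf : Function.Injective f.toLinearMap)
      (hfg : Function.Exact f.toLinearMap g.toLinearMap)
      (hg : Function.Surjective g.toLinearMap)
      (ihA : ModBarInfty r A) (ihC : ModBarInfty r C) : ModBarInfty r B

/-- The underlying `𝔖`-module of `M` is isomorphic to `𝔖^m ⊕ ⨁_{i=1}^n 𝔖/p^{a_i}` for some
`m, n ≥ 0` and `a_i ≥ 1`. -/
def HasFIForm (M : BKModule.{u, w} E) : Prop :=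
  ∃ (m n : ℕ) (a : Fin n → ℕ), (∀ i, 1 ≤ a i) ∧
    Nonempty (M.carrier ≃ₗ[𝔖 p k]
      ((Fin m → 𝔖 p k) × ((i : Fin n) → 𝔖 p k ⧸ Ideal.span {(p : 𝔖 p k) ^ a i})))

/-- The objects of `ModBarInfty r` whose underlying `𝔖`-module is of the above form. -/
def ModFIBarInfty (r : ℕ) (M : BKModule.{u, w} E) : Prop :=
  ModBarInfty r M ∧ HasFIForm M

end BKModule

end BK

end

noncomputable section

namespace BK

/-! ### The Frobenius of `𝔖` and the basis `1, X, …, X ^ (p - 1)` over its image -/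

section Frobenius

variable {p : ℕ} [Fact p.Prime] {k : Type u} [Field k]

/-! It suffices that neither `M` nor any quotient `M / p ^ i` has `X`-torsion. Then generators of
the `W(k)`-module `M / X` lift to `M` with the same annihilators, and Nakayama's lemma identifies
`M` with the corresponding sum of copies of `𝔖` and `𝔖 / p ^ a` (`exists_equiv_of_torsion_free`).

The quotients `M / p ^ i` need not behave well in extensions, so a stronger property is carried
through the induction: `M` cannot be enlarged, by elements that powers of both `p` and `X` move into
it, to another module with a Frobenius whose linearization is injective (`LatticeMaximal`). Kernels
of `p`-power torsion are allowed so that the property applies to `p ^ i : M → M`. If `X m` lies in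
`p ^ i M`, then `m` lies in the saturation of `p ^ i M`, which maximality forces to be `p ^ i M`
itself.

For height at most `r`, maximality comes from `E ≡ u X ^ e` modulo `p`. If `p t` and `X F(t)` lie in
the lattice, height puts `X ^ (e r + 1) F(t)` in the span of the Frobenius image of the lattice.
Since `e r + 1 < p`, this is a single term in the basis `1, …, X ^ (p - 1)`, so `t` was already in
the lattice (`latticeMaximal_of_height`).

For an extension of `C` by `A` mapping to `N`, maximality of `A` makes its image `H` saturated in
`N`. This keeps the linearization on `N / H` injective, and maximality of `C` then applies there
(`LatticeMaximal.of_exact`). -/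

lemma frob_X : frob p k PowerSeries.X = PowerSeries.X ^ p := by
  simp [frob]

lemma coeff_frob_mul (s : 𝔖 p k) (n : ℕ) :
    PowerSeries.coeff (p * n) (frob p k s) = WittVector.frobenius (PowerSeries.coeff n s) := by
  simp [frob, PowerSeries.coeff_expand_mul]

lemma coeff_frob_of_not_dvd (s : 𝔖 p k) {n : ℕ} (h : ¬ p ∣ n) :
    PowerSeries.coeff n (frob p k s) = 0 := by
  simp [frob, PowerSeries.coeff_expand_of_not_dvd _ _ _ h]

/-- The coefficients of `∑ X ^ i * φ (s i)`, where `i` runs over the residues modulo `p`. -/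
lemma coeff_sum_X_pow_mul_frob (s : ℕ → 𝔖 p k) (n i : ℕ) (hi : i < p) :
    PowerSeries.coeff (p * n + i)
      (∑ j ∈ Finset.range p, PowerSeries.X ^ j * frob p k (s j)) =
      WittVector.frobenius (PowerSeries.coeff n (s i)) := by
  rw [map_sum, Finset.sum_eq_single i]
  · rw [PowerSeries.coeff_X_pow_mul, coeff_frob_mul]
  · intro j hj hji
    rw [PowerSeries.coeff_X_pow_mul']
    split_ifs with h
    · refine coeff_frob_of_not_dvd _ fun hd => hji ?_
      have hj := Finset.mem_range.mp hj
      have h1 : j ≡ p * n + i [MOD p] := (Nat.modEq_iff_dvd' h).mpr hd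
      have h2 : p * n + i ≡ i [MOD p] := by simp [Nat.ModEq]
      exact (h1.trans h2).eq_of_lt_of_lt hj hi
    · rfl
  · intro h
    exact absurd (Finset.mem_range.mpr hi) h

/-- `1, X, …, X ^ (p - 1)` generate `𝔖` over its Frobenius image. -/
lemma exists_eq_sum_X_pow_mul_frob [CharP k p] [PerfectRing k p] (s : 𝔖 p k) :
    ∃ t : ℕ → 𝔖 p k, s = ∑ i ∈ Finset.range p, PowerSeries.X ^ i * frob p k (t i) := by
  choose g hg using (WittVector.frobenius_bijective p k).surjective
  refine ⟨fun i => PowerSeries.mk fun n => g (PowerSeries.coeff (p * n + i) s), ?_⟩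
  ext1 m
  have hp : 0 < p := (Fact.out : p.Prime).pos
  rw [← Nat.div_add_mod m p, coeff_sum_X_pow_mul_frob _ _ _ (Nat.mod_lt m hp)]
  simp [hg]

end Frobenius

/-! ### Semilinear Frobenius maps and their linearizations -/

section Semilinear

variable {p : ℕ} [Fact p.Prime] {k : Type u} [Field k]
variable {M : Type w} [AddCommGroup M] [Module (𝔖 p k) M]

/-- The linearization `φ^*M → M` of the semilinear map `F` is injective, expressed through the
basis `1, X, …, X ^ (p - 1)` of `𝔖` over its Frobenius image. -/
def LinearizationInjective (F : M →ₛₗ[frob p k] M) : Prop :=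
  ∀ m : ℕ → M, ∑ i ∈ Finset.range p, (PowerSeries.X : 𝔖 p k) ^ i • F (m i) = 0 →
    ∀ i < p, m i = 0

/-- The image of the linearization `φ^*N → M` of a semilinear map `F`. -/
abbrev frobSpan (F : M →ₛₗ[frob p k] M) (N : Submodule (𝔖 p k) M) : Submodule (𝔖 p k) M :=
  Submodule.span (𝔖 p k) (F '' N)

lemma LinearizationInjective.eq_of_sum_eq {F : M →ₛₗ[frob p k] M} (hF : LinearizationInjective F)
    {m n : ℕ → M} (h : ∑ i ∈ Finset.range p, (PowerSeries.X : 𝔖 p k) ^ i • F (m i) =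
      ∑ i ∈ Finset.range p, (PowerSeries.X : 𝔖 p k) ^ i • F (n i)) {i : ℕ} (hi : i < p) :
    m i = n i := by
  refine sub_eq_zero.mp (hF (fun i => m i - n i) ?_ i hi)
  simp [smul_sub, h]

/-- Coefficients from `𝔖` can be absorbed: each splits along `1, X, …, X ^ (p - 1)` into Frobenius
images, which move inside `F` and act on `N`. -/
lemma exists_of_mem_frobSpan [CharP k p] [PerfectRing k p] {F : M →ₛₗ[frob p k] M}
    {N : Submodule (𝔖 p k) M} {x : M} (hx : x ∈ frobSpan F N) :
    ∃ m : ℕ → M, (∀ i, m i ∈ N) ∧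
      x = ∑ i ∈ Finset.range p, (PowerSeries.X : 𝔖 p k) ^ i • F (m i) := by
  induction hx using Submodule.span_induction with
  | mem x hx =>
    obtain ⟨y, hy, rfl⟩ := hx
    refine ⟨fun i => if i = 0 then y else 0, fun i => ?_, ?_⟩
    · dsimp only
      split_ifs
      exacts [hy, N.zero_mem]
    · rw [Finset.sum_eq_single 0]
      · simp
      · intro i _ hi
        simp [hi]
      · intro h
        exact absurd (Finset.mem_range.mpr (Fact.out : p.Prime).pos) h
  | zero => exact ⟨fun _ => 0, fun _ => N.zero_mem, by simp⟩
  | add x y _ _ hx hy =>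
    obtain ⟨m, hm, rfl⟩ := hx
    obtain ⟨n, hn, rfl⟩ := hy
    exact ⟨fun i => m i + n i, fun i => N.add_mem (hm i) (hn i), by
      simp [smul_add, Finset.sum_add_distrib]⟩
  | smul s x _ hx =>
    obtain ⟨m, hm, rfl⟩ := hx
    choose t ht using fun i : ℕ =>
      exists_eq_sum_X_pow_mul_frob (s * (PowerSeries.X : 𝔖 p k) ^ i)
    refine ⟨fun j => ∑ i ∈ Finset.range p, t i j • m i,
      fun j => N.sum_mem fun i _ => N.smul_mem _ (hm i), ?_⟩
    simp only [Finset.smul_sum, map_sum, LinearMap.map_smulₛₗ]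
    rw [Finset.sum_comm]
    refine Finset.sum_congr rfl fun i _ => ?_
    rw [smul_smul, ht i, Finset.sum_smul]
    simp [mul_smul]

lemma sum_mem_frobSpan {F : M →ₛₗ[frob p k] M} {N : Submodule (𝔖 p k) M} (m : ℕ → M)
    (hm : ∀ i < p, m i ∈ N) :
    ∑ i ∈ Finset.range p, (PowerSeries.X : 𝔖 p k) ^ i • F (m i) ∈ frobSpan F N :=
  Submodule.sum_mem _ fun i hi => Submodule.smul_mem _ _
    (Submodule.subset_span ⟨m i, hm i (Finset.mem_range.mp hi), rfl⟩)

lemma map_X_pow_smul (F : M →ₛₗ[frob p k] M) (n : ℕ) (m : M) :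
    F ((PowerSeries.X : 𝔖 p k) ^ n • m) = (PowerSeries.X : 𝔖 p k) ^ (p * n) • F m := by
  rw [LinearMap.map_smulₛₗ, map_pow, frob_X, pow_mul]

lemma map_p_pow_smul (F : M →ₛₗ[frob p k] M) (n : ℕ) (m : M) :
    F ((p : 𝔖 p k) ^ n • m) = (p : 𝔖 p k) ^ n • F m := by
  rw [LinearMap.map_smulₛₗ, map_pow, map_natCast]

/-- For `i < p` the left side is already an expansion in the basis, with one nonzero term; comparing
coefficients at `i` gives the claim. -/
lemma LinearizationInjective.eq_of_X_pow_smul_eq {F : M →ₛₗ[frob p k] M}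
    (hF : LinearizationInjective F) {i : ℕ} (hi : i < p) {t : M} {m : ℕ → M}
    (h : (PowerSeries.X : 𝔖 p k) ^ i • F t =
      ∑ i ∈ Finset.range p, (PowerSeries.X : 𝔖 p k) ^ i • F (m i)) : t = m i := by
  have := hF.eq_of_sum_eq (m := fun j => if j = i then t else 0) (n := m) (by
    rw [← h, Finset.sum_eq_single i]
    · simp
    · intro j _ hj
      simp [hj]
    · intro h
      exact absurd (Finset.mem_range.mpr hi) h) hi
  simpa using this

/-! ### Maximal lattices and the bound `e * r < p - 1` -/

/-- `M` is maximal among the effective lattices that contain it: any equivariant map from `M` to an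
effective module whose kernel is `p`-power torsion and whose cokernel is killed by powers of `p`
and `X` is surjective. -/
def LatticeMaximal (F : M →ₛₗ[frob p k] M) : Prop :=
  ∀ (N : Type w) [AddCommGroup N] [Module (𝔖 p k) N] [Module.Finite (𝔖 p k) N]
    (G : N →ₛₗ[frob p k] N), LinearizationInjective G →
    ∀ h : M →ₗ[𝔖 p k] N, (∀ m : M, h (F m) = G (h m)) →
    ∀ n : ℕ, (∀ m : M, h m = 0 → (p : 𝔖 p k) ^ n • m = 0) →
      (∀ y : N, (p : 𝔖 p k) ^ n • y ∈ LinearMap.range h) →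
      (∀ y : N, (PowerSeries.X : 𝔖 p k) ^ n • y ∈ LinearMap.range h) →
      Function.Surjective h

lemma map_mem_frobSpan_range {N : Type w} [AddCommGroup N] [Module (𝔖 p k) N]
    {F : M →ₛₗ[frob p k] M} {G : N →ₛₗ[frob p k] N} {h : M →ₗ[𝔖 p k] N}
    (hh : ∀ m, h (F m) = G (h m)) {x : M} (hx : x ∈ frobSpan F ⊤) :
    h x ∈ frobSpan G (LinearMap.range h) := by
  have : (frobSpan F ⊤).map h ≤ frobSpan G (LinearMap.range h) := by
    rw [frobSpan, Submodule.map_span, Submodule.span_le]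
    rintro _ ⟨_, ⟨m, -, rfl⟩, rfl⟩
    exact Submodule.subset_span ⟨h m, ⟨m, rfl⟩, (hh m).symm⟩
  exact this ⟨x, hx, rfl⟩

lemma exists_pow_eq_add {R : Type*} [CommRing R] {E u a b v : R} (hE : E = u * a + b * v) (n : ℕ) :
    ∃ v', E ^ n = u ^ n * a ^ n + b * v' := by
  obtain ⟨c, hc⟩ := sub_dvd_pow_sub_pow E (u * a) n
  exact ⟨v * c, by rw [← mul_pow]; linear_combination hc + c * hE⟩

/-- An effective module of height at most `r` is a maximal lattice if `e * r < p - 1`. -/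
lemma latticeMaximal_of_height [CharP k p] [PerfectRing k p] {E u' v' : 𝔖 p k} {e r : ℕ}
    (hu : IsUnit u') (hE : E = u' * PowerSeries.X ^ e + (p : 𝔖 p k) * v')
    (her : e * r < p - 1) (F : M →ₛₗ[frob p k] M)
    (hF : ∀ m, E ^ r • m ∈ frobSpan F ⊤) : LatticeMaximal F := by
  intro N _ _ _ G hG h hh n _ hpn hXn
  -- The only place where the height and the bound on `e * r` enter. Modulo `p`, `E ^ r` is a unit
  -- times `X ^ (e * r)`, and the error term is harmless because `p • G t = G (p • t)`.
  have key : ∀ t : N, (p : 𝔖 p k) • t ∈ LinearMap.range h →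
      (PowerSeries.X : 𝔖 p k) • G t ∈ LinearMap.range h → t ∈ LinearMap.range h := by
    rintro t hpt ⟨m, hm⟩
    have h1 := map_mem_frobSpan_range hh (hF m)
    rw [map_smul, hm] at h1
    obtain ⟨c, hc⟩ := exists_pow_eq_add hE r
    have h2 : (p : 𝔖 p k) • G t ∈ frobSpan G (LinearMap.range h) := by
      have := map_p_pow_smul G 1 t
      rw [pow_one] at this
      rw [← this]
      exact Submodule.subset_span ⟨_, hpt, rfl⟩
    have h3 : u' ^ r • (PowerSeries.X : 𝔖 p k) ^ (e * r + 1) • G t ∈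
        frobSpan G (LinearMap.range h) := by
      have : u' ^ r • (PowerSeries.X : 𝔖 p k) ^ (e * r + 1) • G t =
          E ^ r • (PowerSeries.X : 𝔖 p k) • G t -
            (c * PowerSeries.X) • (p : 𝔖 p k) • G t := by
        rw [hc, smul_smul, smul_smul, smul_smul, ← sub_smul]
        congr 1
        ring
      rw [this]
      exact Submodule.sub_mem _ h1 (Submodule.smul_mem _ _ h2)
    have h4 : (PowerSeries.X : 𝔖 p k) ^ (e * r + 1) • G t ∈ frobSpan G (LinearMap.range h) := by
      obtain ⟨w, hw⟩ := (hu.pow r).exists_left_inv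
      have := Submodule.smul_mem _ w h3
      rwa [smul_smul, hw, one_smul] at this
    obtain ⟨m, hm, hmt⟩ := exists_of_mem_frobSpan h4
    -- The bound gives `e * r + 1 ≤ p - 1`, so `X ^ (e * r + 1)` is still a basis element.
    rw [hG.eq_of_X_pow_smul_eq (by omega) hmt]
    exact hm _
  -- The exponent `j` drops by one at a time: `key` is applied to `X ^ j • y`, whose Frobenius image
  -- carries the factor `X ^ (p * j)`, and `p * j + 1 ≥ j + 1`.
  have step : ∀ j : ℕ, (∀ y : N, (p : 𝔖 p k) • y ∈ LinearMap.range h →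
      (PowerSeries.X : 𝔖 p k) ^ j • y ∈ LinearMap.range h) →
      ∀ y : N, (p : 𝔖 p k) • y ∈ LinearMap.range h → y ∈ LinearMap.range h := by
    intro j
    induction j with
    | zero => simp
    | succ j ih =>
      intro hj
      refine ih fun y hy => key _ ?_ ?_
      · rw [smul_comm]
        exact Submodule.smul_mem _ _ hy
      · have h1 : (p : 𝔖 p k) • G y ∈ LinearMap.range h := by
          obtain ⟨m, hm⟩ := hy
          refine ⟨F m, ?_⟩
          rw [hh, hm]
          simp
        have h2 := hj _ h1
        obtain ⟨d, hd⟩ : ∃ d, p * j + 1 = d + (j + 1) :=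
          ⟨p * j - j, by have := Nat.le_mul_of_pos_left j (Fact.out : p.Prime).pos; omega⟩
        rw [map_X_pow_smul, smul_smul, ← pow_succ', hd, pow_add, mul_smul]
        exact Submodule.smul_mem _ _ h2
  have hp : ∀ n : ℕ, ∀ y : N, (p : 𝔖 p k) ^ n • y ∈ LinearMap.range h → y ∈ LinearMap.range h := by
    intro i
    induction i with
    | zero => simp
    | succ i ih =>
      intro y hy
      rw [pow_succ', mul_smul] at hy
      exact ih _ (step n (fun y _ => hXn y) _ hy)
  exact fun y => hp n y (hpn y)

/-! ### Saturations, extensions and `X`-torsion -/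

/-- The elements that multiplication by `X ^ j` and by `p ^ j` moves into `H`. -/
def saturation (H : Submodule (𝔖 p k) M) : ℕ →o Submodule (𝔖 p k) M where
  toFun j := H.comap ((PowerSeries.X : 𝔖 p k) ^ j • LinearMap.id) ⊓
    H.comap ((p : 𝔖 p k) ^ j • LinearMap.id)
  monotone' i j hij x hx := by
    obtain ⟨d, rfl⟩ := Nat.exists_eq_add_of_le' hij
    simp only [Submodule.mem_inf, Submodule.mem_comap, LinearMap.smul_apply, LinearMap.id_apply,
      pow_add, mul_smul] at hx ⊢
    exact ⟨H.smul_mem _ hx.1, H.smul_mem _ hx.2⟩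

lemma mem_saturation {H : Submodule (𝔖 p k) M} {j : ℕ} {x : M} :
    x ∈ saturation H j ↔ (PowerSeries.X : 𝔖 p k) ^ j • x ∈ H ∧ (p : 𝔖 p k) ^ j • x ∈ H :=
  Iff.rfl

lemma le_saturation (H : Submodule (𝔖 p k) M) (j : ℕ) : H ≤ saturation H j :=
  fun _ hx => ⟨H.smul_mem _ hx, H.smul_mem _ hx⟩

/-- The saturations form an increasing chain in a Noetherian module. A stable one is finitely
generated, so it can serve as a target in `LatticeMaximal`. -/
lemma exists_saturation_eq [CharP k p] [PerfectRing k p] [Module.Finite (𝔖 p k) M]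
    (H : Submodule (𝔖 p k) M) : ∃ J, ∀ j, J ≤ j → saturation H J = saturation H j :=
  monotone_stabilizes_iff_noetherian.mpr inferInstance (saturation H)

/-- A stable saturation of a stable submodule is stable. -/
lemma map_mem_saturation {F : M →ₛₗ[frob p k] M} {H : Submodule (𝔖 p k) M}
    (hH : ∀ x ∈ H, F x ∈ H) {J : ℕ} (hJ : ∀ j, J ≤ j → saturation H J = saturation H j) :
    ∀ x ∈ saturation H J, F x ∈ saturation H J := by
  intro x hx
  have hp := (Fact.out : p.Prime).pos
  -- Frobenius turns `X ^ J` into `X ^ (p * J)`, so the image lands a priori in the saturation of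
  -- level `p * J`, which equals that of level `J`.
  rw [hJ (p * J) (Nat.le_mul_of_pos_left J hp), mem_saturation]
  refine ⟨map_X_pow_smul F J x ▸ hH _ hx.1, ?_⟩
  obtain ⟨d, hd⟩ := Nat.exists_eq_add_of_le' (Nat.le_mul_of_pos_left J hp)
  rw [hd, pow_add, mul_smul]
  exact H.smul_mem _ (map_p_pow_smul F J x ▸ hH _ hx.2)

/-- The restriction of a semilinear map to a stable submodule. -/
def restrictFrob (F : M →ₛₗ[frob p k] M) (H : Submodule (𝔖 p k) M) (hH : ∀ x ∈ H, F x ∈ H) :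
    H →ₛₗ[frob p k] H where
  toFun x := ⟨F x, hH x x.2⟩
  map_add' x y := Subtype.ext (map_add F x.1 y.1)
  map_smul' s x := Subtype.ext (F.map_smulₛₗ s x.1)

lemma LinearizationInjective.restrictFrob {F : M →ₛₗ[frob p k] M} (hF : LinearizationInjective F)
    (H : Submodule (𝔖 p k) M) (hH : ∀ x ∈ H, F x ∈ H) :
    LinearizationInjective (restrictFrob F H hH) := by
  intro m hm i hi
  refine Subtype.ext (hF (fun i => (m i : M)) ?_ i hi)
  simpa [BK.restrictFrob] using congrArg H.subtype hm

/-- The linearization of an extension of modules with injective linearizations is injective. -/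
lemma LinearizationInjective.of_exact {A B C : Type w}
    [AddCommGroup A] [Module (𝔖 p k) A] [AddCommGroup B] [Module (𝔖 p k) B]
    [AddCommGroup C] [Module (𝔖 p k) C] {FA : A →ₛₗ[frob p k] A} {FB : B →ₛₗ[frob p k] B}
    {FC : C →ₛₗ[frob p k] C} {f : A →ₗ[𝔖 p k] B} {g : B →ₗ[𝔖 p k] C}
    (hf : Function.Injective f) (hfg : Function.Exact f g)
    (hfF : ∀ a, f (FA a) = FB (f a)) (hgF : ∀ b, g (FB b) = FC (g b))
    (hA : LinearizationInjective FA) (hC : LinearizationInjective FC) :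
    LinearizationInjective FB := by
  intro m hm
  have h1 : ∀ i < p, g (m i) = 0 := hC (fun i => g (m i)) (by
    simpa [hgF] using congrArg g hm)
  choose! a ha using fun i (hi : i < p) => (hfg (m i)).mp (h1 i hi)
  intro i hi
  rw [← ha i hi, hA a (hf ?_) i hi, map_zero]
  rw [map_zero, ← hm, map_sum]
  refine Finset.sum_congr rfl fun j hj => ?_
  rw [map_smul, hfF, ha j (Finset.mem_range.mp hj)]

/-- A power of `X` lies in every ideal that contains powers of `E` and `p`. -/
lemma X_pow_mem_of_mem {E u' v' : 𝔖 p k} {e : ℕ}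
    (hu : IsUnit u') (hE : E = u' * PowerSeries.X ^ e + (p : 𝔖 p k) * v') {I : Ideal (𝔖 p k)}
    {a b : ℕ} (ha : E ^ a ∈ I) (hb : (p : 𝔖 p k) ^ b ∈ I) : ∃ c, (PowerSeries.X : 𝔖 p k) ^ c ∈ I := by
  have h1 : u' * PowerSeries.X ^ e ∈ I.radical := by
    rw [show u' * PowerSeries.X ^ e = E - (p : 𝔖 p k) * v' by rw [hE]; ring]
    exact Ideal.sub_mem _ ⟨a, ha⟩ (Ideal.mul_mem_right _ _ ⟨b, hb⟩)
  obtain ⟨n, hn⟩ := (Ideal.unit_mul_mem_iff_mem _ hu).mp h1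
  exact ⟨e * n, by rwa [pow_mul]⟩

/-- An extension of maximal lattices is a maximal lattice. -/
lemma LatticeMaximal.of_exact [CharP k p] [PerfectRing k p] {E u' v' : 𝔖 p k} {e : ℕ}
    (hu : IsUnit u') (hE : E = u' * PowerSeries.X ^ e + (p : 𝔖 p k) * v') {A B C : Type w}
    [AddCommGroup A] [Module (𝔖 p k) A] [AddCommGroup B] [Module (𝔖 p k) B]
    [AddCommGroup C] [Module (𝔖 p k) C] {FA : A →ₛₗ[frob p k] A} {FB : B →ₛₗ[frob p k] B}
    {FC : C →ₛₗ[frob p k] C} {f : A →ₗ[𝔖 p k] B} {g : B →ₗ[𝔖 p k] C}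
    (hf : Function.Injective f) (hfg : Function.Exact f g) (hg : Function.Surjective g)
    (hfF : ∀ a, f (FA a) = FB (f a)) (hgF : ∀ b, g (FB b) = FC (g b))
    (hCinj : LinearizationInjective FC) {l : ℕ} (hAl : ∀ a, E ^ l • a ∈ frobSpan FA ⊤)
    (hA : LatticeMaximal FA) (hC : LatticeMaximal FC) : LatticeMaximal FB := by
  intro N _ _ _ G hG h hh n hker hpn hXn
  have hhf : ∀ a, (h ∘ₗ f) (FA a) = G ((h ∘ₗ f) a) := fun a => by simp [hfF, hh]
  set H := LinearMap.range (h ∘ₗ f) with hH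
  have hHG : ∀ x ∈ H, G x ∈ H := by
    rintro _ ⟨a, rfl⟩
    exact ⟨FA a, hhf a⟩
  obtain ⟨J, hJ⟩ := exists_saturation_eq H
  have hsat : saturation H J = H := by
    have hstab := map_mem_saturation hHG hJ
    -- Maximality of `A` is tested on its image inside the saturation of that image. The exponent
    -- `max n J` serves both the kernel, killed by `p ^ n`, and the cokernel, killed by `p ^ J` and
    -- `X ^ J`.
    have hsurj := hA (saturation H J) (restrictFrob G _ hstab) (hG.restrictFrob _ hstab)
      ((h ∘ₗ f).codRestrict _ fun a => le_saturation H J ⟨a, rfl⟩)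
      (fun a => Subtype.ext (hhf a)) (max n J)
      (fun a ha => by
        have h1 : h (f a) = 0 := congrArg Subtype.val ha
        obtain ⟨d, hd⟩ := Nat.exists_eq_add_of_le' (le_max_left n J)
        rw [hd, pow_add, mul_smul]
        have : (p : 𝔖 p k) ^ n • a = 0 := hf (by rw [map_smul, hker _ h1, map_zero])
        rw [this, smul_zero])
      (fun y => by
        have hy := ((saturation H).monotone (le_max_right n J) y.2).2
        obtain ⟨a, ha⟩ := hy
        exact ⟨a, Subtype.ext ha⟩)
      (fun y => by
        have hy := ((saturation H).monotone (le_max_right n J) y.2).1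
        obtain ⟨a, ha⟩ := hy
        exact ⟨a, Subtype.ext ha⟩)
    refine le_antisymm (fun x hx => ?_) (le_saturation H J)
    obtain ⟨a, ha⟩ := hsurj ⟨x, hx⟩
    exact ⟨a, congrArg Subtype.val ha⟩
  have hsat' : ∀ x i j, (PowerSeries.X : 𝔖 p k) ^ i • x ∈ H → (p : 𝔖 p k) ^ j • x ∈ H → x ∈ H := by
    intro x i j hi hj
    rw [← hsat, hJ (J + i + j) (by omega), mem_saturation]
    constructor
    · rw [show J + i + j = J + j + i by omega, pow_add, mul_smul]
      exact H.smul_mem _ hi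
    · rw [pow_add, mul_smul]
      exact H.smul_mem _ hj
  -- the quotient by the image of `A`
  let G' : (N ⧸ H) →ₛₗ[frob p k] (N ⧸ H) := H.mapQ H G hHG
  have hG'mk : ∀ x, G' (H.mkQ x) = H.mkQ (G x) := fun x => rfl
  have hgker : LinearMap.ker g ≤ LinearMap.ker (H.mkQ ∘ₗ h) := by
    intro b hb
    obtain ⟨a, rfl⟩ := (hfg b).mp hb
    simp only [LinearMap.mem_ker, LinearMap.comp_apply, Submodule.mkQ_apply,
      Submodule.Quotient.mk_eq_zero]
    exact ⟨a, rfl⟩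
  let hbar : C →ₗ[𝔖 p k] (N ⧸ H) :=
    (LinearMap.ker g).liftQ (H.mkQ ∘ₗ h) hgker ∘ₗ
      (g.quotKerEquivOfSurjective hg).symm.toLinearMap
  have hbar_g : ∀ b, hbar (g b) = H.mkQ (h b) := by
    intro b
    have : (g.quotKerEquivOfSurjective hg).symm (g b) = Submodule.Quotient.mk b := by
      rw [LinearEquiv.symm_apply_eq]
      rfl
    simp [hbar, this]
  have hbarF : ∀ c, hbar (FC c) = G' (hbar c) := by
    intro c
    obtain ⟨b, rfl⟩ := hg c
    rw [← hgF, hbar_g, hbar_g, hG'mk, hh]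
  have hbarker : ∀ c, hbar c = 0 → (p : 𝔖 p k) ^ n • c = 0 := by
    intro c hc
    obtain ⟨b, rfl⟩ := hg c
    rw [hbar_g, Submodule.mkQ_apply, Submodule.Quotient.mk_eq_zero] at hc
    obtain ⟨a, ha⟩ := hc
    have h1 := hker (b - f a) (by rw [map_sub, sub_eq_zero]; exact ha.symm)
    have h2 : g (f a) = 0 := hfg.apply_apply_eq_zero a
    simpa [h2] using congrArg g h1
  have hrange : ∀ (s : 𝔖 p k), (∀ y, s • y ∈ LinearMap.range h) →
      ∀ y, s • y ∈ LinearMap.range hbar := by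
    intro s hs y
    obtain ⟨y, rfl⟩ := H.mkQ_surjective y
    obtain ⟨b, hb⟩ := hs y
    exact ⟨g b, by rw [hbar_g, hb, map_smul]⟩
  -- A relation in `N ⧸ H` lifts to an element `x` of `H`. Powers of `E` (finite height of `A`) and
  -- of `p` (injectivity for `C`) both move `x` into `frobSpan G H`, hence so does a power of `X`.
  -- Comparing coefficients and using saturatedness of `H` puts every `y i` in `H`.
  have hG'inj : LinearizationInjective G' := by
    intro m hm
    choose y hy using fun i => H.mkQ_surjective (m i)
    set x := ∑ i ∈ Finset.range p, (PowerSeries.X : 𝔖 p k) ^ i • G (y i) with hx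
    have hxH : x ∈ H := by
      rw [← Submodule.Quotient.mk_eq_zero, ← Submodule.mkQ_apply, hx, map_sum, ← hm]
      refine Finset.sum_congr rfl fun i _ => ?_
      rw [map_smul, ← hG'mk, hy]
    have h1 : E ^ l • x ∈ frobSpan G H := by
      obtain ⟨a, ha⟩ := hxH
      rw [← ha, ← map_smul]
      exact map_mem_frobSpan_range hhf (hAl a)
    -- One factor `p ^ n` moves `y i` into the image of `h`; the other kills the kernel of `hbar`.
    have h2 : ∀ i < p, (p : 𝔖 p k) ^ (n + n) • y i ∈ H := by
      choose b hb using fun i => hpn (y i)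
      have hb' : ∀ i, hbar (g (b i)) = (p : 𝔖 p k) ^ n • m i := fun i => by
        rw [hbar_g, hb, map_smul, hy]
      have h3 : (p : 𝔖 p k) ^ n • ∑ i ∈ Finset.range p,
          (PowerSeries.X : 𝔖 p k) ^ i • FC (g (b i)) = 0 := by
        refine hbarker _ ?_
        rw [← smul_zero ((p : 𝔖 p k) ^ n), ← hm, map_sum, Finset.smul_sum]
        refine Finset.sum_congr rfl fun i _ => ?_
        rw [map_smul, hbarF, hb', map_p_pow_smul, smul_comm]
      have h4 := hCinj (fun i => (p : 𝔖 p k) ^ n • g (b i)) (by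
        rw [← h3, Finset.smul_sum]
        refine Finset.sum_congr rfl fun i _ => ?_
        rw [map_p_pow_smul, smul_comm])
      intro i hi
      rw [← Submodule.Quotient.mk_eq_zero, ← Submodule.mkQ_apply, map_smul, hy, pow_add, mul_smul,
        ← hb', ← map_smul, h4 i hi, map_zero]
    have h5 : (p : 𝔖 p k) ^ (n + n) • x ∈ frobSpan G H := by
      have : (p : 𝔖 p k) ^ (n + n) • x = ∑ i ∈ Finset.range p,
          (PowerSeries.X : 𝔖 p k) ^ i • G ((p : 𝔖 p k) ^ (n + n) • y i) := by
        rw [hx, Finset.smul_sum]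
        refine Finset.sum_congr rfl fun i _ => ?_
        rw [map_p_pow_smul, smul_comm]
      rw [this]
      exact sum_mem_frobSpan _ h2
    obtain ⟨c, hc⟩ := X_pow_mem_of_mem hu hE
      (I := (frobSpan G H).comap (LinearMap.toSpanSingleton (𝔖 p k) N x)) h1 h5
    -- The exponent is raised to a multiple of `p` so that the power of `X` passes through `G`.
    have h6 : (PowerSeries.X : 𝔖 p k) ^ (p * c) • x ∈ frobSpan G H := by
      obtain ⟨d, hd⟩ := Nat.exists_eq_add_of_le'
        (Nat.le_mul_of_pos_left c (Fact.out : p.Prime).pos)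
      rw [hd, pow_add, mul_smul]
      exact Submodule.smul_mem _ _ hc
    obtain ⟨t, ht, htx⟩ := exists_of_mem_frobSpan h6
    intro i hi
    rw [← hy, Submodule.mkQ_apply, Submodule.Quotient.mk_eq_zero]
    refine hsat' _ c _ ?_ (h2 i hi)
    have := hG.eq_of_sum_eq (m := fun i => (PowerSeries.X : 𝔖 p k) ^ c • y i) (n := t) (by
      rw [← htx, hx, Finset.smul_sum]
      refine Finset.sum_congr rfl fun i _ => ?_
      rw [map_X_pow_smul, smul_comm]) hi
    exact this ▸ ht i
  have hsurj := hC (N ⧸ H) G' hG'inj hbar hbarF n hbarker (hrange _ hpn) (hrange _ hXn)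
  intro y
  obtain ⟨c, hc⟩ := hsurj (H.mkQ y)
  obtain ⟨b, rfl⟩ := hg c
  rw [hbar_g, eq_comm, ← sub_eq_zero, ← map_sub, Submodule.mkQ_apply,
    Submodule.Quotient.mk_eq_zero] at hc
  obtain ⟨a, ha⟩ := hc
  exact ⟨b + f a, by rw [map_add, ← LinearMap.comp_apply, ha]; abel⟩

/-- The quotients `M / p ^ i` of a maximal lattice have no `X`-torsion. -/
lemma LatticeMaximal.exists_eq_p_pow_smul [CharP k p] [PerfectRing k p] [Module.Finite (𝔖 p k) M]
    {F : M →ₛₗ[frob p k] M} (hinj : LinearizationInjective F) (hF : LatticeMaximal F)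
    (i : ℕ) {m m' : M} (h : (PowerSeries.X : 𝔖 p k) • m = (p : 𝔖 p k) ^ i • m') :
    ∃ m'', m = (p : 𝔖 p k) ^ i • m'' := by
  let q : M →ₗ[𝔖 p k] M := (p : 𝔖 p k) ^ i • LinearMap.id
  have hq : ∀ x, q (F x) = F (q x) := fun x => (map_p_pow_smul F i x).symm
  have hqF : ∀ x ∈ LinearMap.range q, F x ∈ LinearMap.range q := by
    rintro _ ⟨x, rfl⟩
    exact ⟨F x, hq x⟩
  obtain ⟨J, hJ⟩ := exists_saturation_eq (LinearMap.range q)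
  have hstab := map_mem_saturation hqF hJ
  -- The map tested is `p ^ i` from `M` to the saturation of `p ^ i M`; its kernel is `p`-power
  -- torsion but need not vanish.
  have hsurj := hF (saturation (LinearMap.range q) J) (restrictFrob F _ hstab)
    (hinj.restrictFrob _ hstab) (q.codRestrict _ fun x => le_saturation _ J ⟨x, rfl⟩)
    (fun x => Subtype.ext (hq x)) (max i J)
    (fun x hx => by
      have h1 : (p : 𝔖 p k) ^ i • x = 0 := congrArg Subtype.val hx
      obtain ⟨d, hd⟩ := Nat.exists_eq_add_of_le' (le_max_left i J)
      rw [hd, pow_add, mul_smul, h1, smul_zero])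
    (fun y => by
      obtain ⟨a, ha⟩ := ((saturation (LinearMap.range q)).monotone (le_max_right i J) y.2).2
      exact ⟨a, Subtype.ext ha⟩)
    (fun y => by
      obtain ⟨a, ha⟩ := ((saturation (LinearMap.range q)).monotone (le_max_right i J) y.2).1
      exact ⟨a, Subtype.ext ha⟩)
  have hm : m ∈ saturation (LinearMap.range q) J := by
    rw [hJ (J + i + 1) (by omega), mem_saturation]
    constructor
    · rw [pow_succ, mul_smul, h]
      exact Submodule.smul_mem _ _ ⟨m', rfl⟩
    · rw [show J + i + 1 = J + 1 + i by omega, pow_add, mul_smul]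
      exact Submodule.smul_mem _ _ ⟨m, rfl⟩
  obtain ⟨x, hx⟩ := hsurj ⟨m, hm⟩
  exact ⟨x, (congrArg Subtype.val hx).symm⟩

end Semilinear

/-! ### From `M / X` over `W(k)` to `M` over `𝔖` -/

section Structure

/-- Structure theorem over `W(k)`: finitely generated modules are sums of copies of `W(k)` and
of nonzero `W(k)/p^a`. -/
lemma exists_equiv_of_finite_wittVector (p : ℕ) [Fact p.Prime] (k : Type u) [Field k] [CharP k p]
    [PerfectRing k p] (M : Type w) [AddCommGroup M] [Module (WittVector p k) M]
    [Module.Finite (WittVector p k) M] :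
    ∃ (m n : ℕ) (a : Fin n → ℕ), (∀ i, 1 ≤ a i) ∧
      Nonempty (M ≃ₗ[WittVector p k] ((Fin m → WittVector p k) ×
        ((i : Fin n) → WittVector p k ⧸ Ideal.span {(p : WittVector p k) ^ a i}))) := by
  classical
  obtain ⟨m, ι, _, q, hq, e, ⟨f⟩⟩ := Module.equiv_free_prod_directSum (WittVector p k) M
  have hspan : ∀ i, Ideal.span {q i ^ e i} = Ideal.span {(p : WittVector p k) ^ e i} := by
    intro i
    rw [Ideal.span_singleton_eq_span_singleton]
    exact (IsDiscreteValuationRing.associated_of_irreducible _ (hq i)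
      (WittVector.irreducible p)).pow_pow
  -- Summands with exponent zero are trivial and are discarded, so that all exponents are at least
  -- `1`.
  let ι' := {i : ι // e i ≠ 0}
  let σ := Fintype.equivFin ι'
  let res : ((i : ι) → WittVector p k ⧸ Ideal.span {q i ^ e i}) →ₗ[WittVector p k]
      ((i : ι') → WittVector p k ⧸ Ideal.span {q i ^ e i}) :=
    LinearMap.pi fun i => LinearMap.proj i.1
  have hres : Function.Bijective res := by
    constructor
    · intro x y hxy
      funext i
      by_cases hi : e i = 0
      · have : Subsingleton (WittVector p k ⧸ Ideal.span {q i ^ e i}) := by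
          rw [Ideal.Quotient.subsingleton_iff, hi, pow_zero, Ideal.span_singleton_one]
        exact Subsingleton.elim _ _
      · exact congrFun hxy ⟨i, hi⟩
    · intro x
      refine ⟨fun i => if hi : e i ≠ 0 then x ⟨i, hi⟩ else 0, ?_⟩
      funext i
      exact dif_pos i.2
  refine ⟨m, Fintype.card ι', fun i => e (σ.symm i), fun i => Nat.one_le_iff_ne_zero.mpr
    (σ.symm i).2, ⟨f.trans (LinearEquiv.prodCongr
      (Finsupp.linearEquivFunOnFinite (WittVector p k) (WittVector p k) (Fin m)) ?_)⟩⟩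
  exact (DirectSum.linearEquivFunOnFintype _ _ _).trans <| (LinearEquiv.ofBijective res hres).trans
    <| (LinearEquiv.piCongrLeft' _ _ σ).trans <|
      LinearEquiv.piCongrRight fun i => Submodule.quotEquivOfEq _ _ (hspan _)

variable {p : ℕ} [Fact p.Prime] {k : Type u} [Field k]
variable {M : Type w} [AddCommGroup M] [Module (𝔖 p k) M]

lemma X_mem_jacobson_bot {R : Type*} [CommRing R] :
    Ideal.span {(PowerSeries.X : R⟦X⟧)} ≤ (⊥ : Ideal R⟦X⟧).jacobson := by
  rw [Ideal.span_singleton_le_iff_mem, Ideal.mem_jacobson_bot]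
  intro y
  rw [PowerSeries.isUnit_iff_constantCoeff]
  simp

lemma exists_eq_C_add_X_mul {R : Type*} [CommRing R] (s : R⟦X⟧) :
    ∃ t, s = PowerSeries.C (PowerSeries.constantCoeff s) + PowerSeries.X * t := by
  obtain ⟨t, ht⟩ := PowerSeries.X_dvd_iff.mpr
    (show PowerSeries.constantCoeff (s - PowerSeries.C (PowerSeries.constantCoeff s)) = 0 by simp)
  exact ⟨t, by rw [← ht]; ring⟩

/-- A finitely generated `𝔖`-module `M` such that `M` and all `M / p ^ i` have no `X`-torsion
is a sum of copies of `𝔖` and of `𝔖 / p ^ a`. -/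
theorem exists_equiv_of_torsion_free [CharP k p] [PerfectRing k p] [Module.Finite (𝔖 p k) M]
    (h0 : ∀ m : M, (PowerSeries.X : 𝔖 p k) • m = 0 → m = 0)
    (hp : ∀ (i : ℕ) (m m' : M), (PowerSeries.X : 𝔖 p k) • m = (p : 𝔖 p k) ^ i • m' →
      ∃ m'', m = (p : 𝔖 p k) ^ i • m'') :
    ∃ (m n : ℕ) (a : Fin n → ℕ), (∀ i, 1 ≤ a i) ∧
      Nonempty (M ≃ₗ[𝔖 p k] ((Fin m → 𝔖 p k) ×
        ((i : Fin n) → 𝔖 p k ⧸ Ideal.span {(p : 𝔖 p k) ^ a i}))) := by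
  classical
  let XM : Submodule (𝔖 p k) M := Ideal.span {(PowerSeries.X : 𝔖 p k)} • ⊤
  have hXM : ∀ x, x ∈ XM ↔ ∃ y, x = (PowerSeries.X : 𝔖 p k) • y := by
    intro x
    simp only [XM, Submodule.ideal_span_singleton_smul, Submodule.mem_smul_pointwise_iff_exists]
    simp [eq_comm]
  let Q := M ⧸ XM
  let _ : Module (WittVector p k) Q := Module.compHom Q (PowerSeries.C (R := WittVector p k))
  have hsmul : ∀ (a : WittVector p k) (x : M),
      a • (XM.mkQ x : Q) = XM.mkQ (PowerSeries.C a • x) := fun a x => rfl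
  have hmk : ∀ (s : 𝔖 p k) (x : M),
      XM.mkQ (s • x) = PowerSeries.constantCoeff s • (XM.mkQ x : Q) := by
    intro s x
    obtain ⟨t, ht⟩ := exists_eq_C_add_X_mul s
    rw [hsmul, ← sub_eq_zero, ← map_sub, ← sub_smul, Submodule.mkQ_apply,
      Submodule.Quotient.mk_eq_zero, hXM]
    exact ⟨t • x, by rw [smul_smul]; congr 1; nth_rw 1 [ht]; ring⟩
  have hsmulQ : ∀ (s : 𝔖 p k) (y : Q), s • y = PowerSeries.constantCoeff s • y := by
    intro s y
    obtain ⟨y, rfl⟩ := XM.mkQ_surjective y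
    rw [← hmk, map_smul]
  have : Module.Finite (WittVector p k) Q := by
    obtain ⟨s, hs⟩ := (Module.Finite.fg_top : (⊤ : Submodule (𝔖 p k) Q).FG)
    refine ⟨s, ?_⟩
    rw [eq_top_iff]
    intro x _
    have hx : x ∈ Submodule.span (𝔖 p k) (s : Set Q) := hs ▸ Submodule.mem_top
    induction hx using Submodule.span_induction with
    | mem x hx => exact Submodule.subset_span hx
    | zero => exact Submodule.zero_mem _
    | add x y _ _ hx hy => exact Submodule.add_mem _ (hx trivial) (hy trivial)
    | smul t x _ hx =>
      rw [hsmulQ]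
      exact Submodule.smul_mem _ _ (hx trivial)
  obtain ⟨m, n, a, ha, ⟨f⟩⟩ := exists_equiv_of_finite_wittVector p k Q
  refine ⟨m, n, a, ha, ?_⟩
  -- lifts of the generators of `M / X`
  choose lift hlift using XM.mkQ_surjective
  let x : Fin m → M := fun i => lift (f.symm (Pi.single i 1, 0))
  -- An arbitrary lift satisfies only `p ^ a • y = X • y'`. Since `M / p ^ a` has no `X`-torsion,
  -- `y' = p ^ a • y''`, and `y - X • y''` is a lift killed by `p ^ a`.
  have hy : ∀ i : Fin n, ∃ y : M, (XM.mkQ y : Q) = f.symm (0, Pi.single i 1) ∧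
      (p : 𝔖 p k) ^ a i • y = 0 := by
    intro i
    set y := lift (f.symm (0, Pi.single i 1)) with hy
    have h1 : (p : 𝔖 p k) ^ a i • y ∈ XM := by
      rw [← Submodule.Quotient.mk_eq_zero, ← Submodule.mkQ_apply, hmk, hlift, ← map_smul,
        map_eq_zero_iff f.symm f.symm.injective, Prod.smul_mk, smul_zero, Prod.mk_eq_zero]
      refine ⟨rfl, ?_⟩
      rw [← Pi.single_smul, Pi.single_eq_zero_iff, map_pow, map_natCast, Algebra.smul_def, mul_one]
      exact Ideal.Quotient.eq_zero_iff_mem.mpr (Ideal.mem_span_singleton_self _)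
    obtain ⟨y', hy'⟩ := (hXM _).mp h1
    obtain ⟨y'', rfl⟩ := hp (a i) y' y hy'.symm
    refine ⟨y - (PowerSeries.X : 𝔖 p k) • y'', ?_, ?_⟩
    · rw [map_sub, hlift, sub_eq_self, Submodule.mkQ_apply, Submodule.Quotient.mk_eq_zero, hXM]
      exact ⟨_, rfl⟩
    · rw [smul_sub, hy', smul_comm, sub_self]
  choose y hyQ hyp using hy
  let gx : (Fin m → 𝔖 p k) →ₗ[𝔖 p k] M :=
    ∑ i, (LinearMap.toSpanSingleton (𝔖 p k) M (x i)) ∘ₗ LinearMap.proj i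
  let gy : ((i : Fin n) → 𝔖 p k ⧸ Ideal.span {(p : 𝔖 p k) ^ a i}) →ₗ[𝔖 p k] M :=
    ∑ i, ((Ideal.span {(p : 𝔖 p k) ^ a i}).liftQ (LinearMap.toSpanSingleton (𝔖 p k) M (y i)) (by
      rw [Ideal.span, Submodule.span_singleton_le_iff_mem]
      exact hyp i)) ∘ₗ LinearMap.proj i
  let g := gx.coprod gy
  have hg : ∀ (s : Fin m → 𝔖 p k) (t : Fin n → 𝔖 p k),
      g (s, fun i => Ideal.Quotient.mk _ (t i)) = ∑ i, s i • x i + ∑ i, t i • y i := by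
    intro s t
    simp only [g, gx, gy, LinearMap.coprod_apply, LinearMap.sum_apply]
    rfl
  have hgQ : ∀ (s : Fin m → 𝔖 p k) (t : Fin n → 𝔖 p k),
      (XM.mkQ (g (s, fun i => Ideal.Quotient.mk _ (t i))) : Q) =
        f.symm (fun i => PowerSeries.constantCoeff (s i),
          fun i => Ideal.Quotient.mk _ (PowerSeries.constantCoeff (t i))) := by
    intro s t
    rw [hg, map_add, map_sum, map_sum]
    simp only [hmk, hyQ, x, hlift]
    rw [← LinearEquiv.symm_apply_eq, LinearEquiv.symm_symm]
    simp only [map_add, map_sum, map_smul, LinearEquiv.apply_symm_apply]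
    ext i
    · simp [Prod.fst_sum, Finset.sum_apply, Pi.single_apply]
    · simp only [Prod.snd_add, Prod.snd_sum, Prod.smul_snd, smul_zero, Finset.sum_const_zero,
        zero_add, Finset.sum_apply, Pi.smul_apply]
      rw [Finset.sum_eq_single i]
      · simp [Algebra.smul_def]
      · intro j _ hj
        simp [hj.symm]
      · simp
  have hsurj : Function.Surjective g := by
    rw [← LinearMap.range_eq_top, eq_top_iff]
    refine Submodule.le_of_le_smul_of_le_jacobson_bot Module.Finite.fg_top X_mem_jacobson_bot ?_
    intro z _
    obtain ⟨⟨s, t⟩, hst⟩ := f.symm.surjective (XM.mkQ z)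
    choose t' ht' using fun i => Ideal.Quotient.mk_surjective (t i)
    have h1 := hgQ (fun i => PowerSeries.C (s i)) (fun i => PowerSeries.C (t' i))
    simp only [PowerSeries.constantCoeff_C, ht'] at h1
    rw [hst, eq_comm, ← sub_eq_zero, ← map_sub, Submodule.mkQ_apply,
      Submodule.Quotient.mk_eq_zero] at h1
    exact Submodule.mem_sup.mpr ⟨_, ⟨_, rfl⟩, _, h1, add_sub_cancel _ _⟩
  -- The kernel `K` satisfies `K ≤ X K`: its elements vanish modulo `X`, hence are `X` times
  -- something, which lies in `K` because `M` has no `X`-torsion. Nakayama's lemma gives `K = 0`.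
  have hinj : Function.Injective g := by
    rw [← LinearMap.ker_eq_bot]
    refine Submodule.eq_bot_of_le_smul_of_le_jacobson_bot _ _ (IsNoetherian.noetherian _) ?_
      X_mem_jacobson_bot
    rintro ⟨s, t⟩ hst
    choose t' ht' using fun i => Ideal.Quotient.mk_surjective (t i)
    obtain rfl : t = fun i => Ideal.Quotient.mk _ (t' i) := funext fun i => (ht' i).symm
    have h1 := hgQ s t'
    rw [LinearMap.mem_ker.mp hst, map_zero, eq_comm, map_eq_zero_iff f.symm f.symm.injective,
      Prod.mk_eq_zero] at h1
    choose s₁ hs₁ using fun i => exists_eq_C_add_X_mul (s i)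
    choose t₁ ht₁ using fun i => exists_eq_C_add_X_mul (t' i)
    have h2 : ((s, fun i => Ideal.Quotient.mk _ (t' i)) : (Fin m → 𝔖 p k) ×
        ((i : Fin n) → 𝔖 p k ⧸ Ideal.span {(p : 𝔖 p k) ^ a i})) =
        (PowerSeries.X : 𝔖 p k) • (s₁, fun i => Ideal.Quotient.mk _ (t₁ i)) := by
      rw [Prod.smul_mk, Prod.mk.injEq]
      constructor
      · funext i
        rw [hs₁ i, show PowerSeries.constantCoeff (s i) = 0 from congrFun h1.1 i]
        simp
      · funext i
        have h3 : PowerSeries.constantCoeff (t' i) ∈ Ideal.span {(p : WittVector p k) ^ a i} :=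
          Ideal.Quotient.eq_zero_iff_mem.mp (congrFun h1.2 i)
        obtain ⟨w, hw⟩ := Ideal.mem_span_singleton.mp h3
        change _ = Ideal.Quotient.mk _ (PowerSeries.X * t₁ i)
        rw [Ideal.Quotient.eq, Ideal.mem_span_singleton]
        refine ⟨PowerSeries.C w, ?_⟩
        nth_rw 1 [ht₁ i]
        rw [hw, map_mul, map_pow, map_natCast]
        ring
    rw [h2]
    refine Submodule.smul_mem_smul (Ideal.mem_span_singleton_self _) (LinearMap.mem_ker.mpr ?_)
    refine h0 _ ?_
    rw [← map_smul, ← h2]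
    exact hst
  exact ⟨(LinearEquiv.ofBijective g ⟨hinj, hsurj⟩).symm⟩

end Structure

/-! ### The Eisenstein polynomial modulo `p` -/

section Eisenstein

variable {p : ℕ} [Fact p.Prime] {k : Type u} [Field k] [CharP k p] [PerfectRing k p]

lemma isUnit_of_not_p_dvd {a : WittVector p k} (ha : ¬ (p : WittVector p k) ∣ a) : IsUnit a := by
  by_contra h
  have h1 := (IsLocalRing.mem_maximalIdeal a).mpr h
  rw [(IsDiscreteValuationRing.irreducible_iff_uniformizer _).mp (WittVector.irreducible p)] at h1
  exact ha (Ideal.mem_span_singleton.mp h1)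

/-- A power series with a coefficient prime to `p` is a unit times a power of `X` modulo `p`. -/
lemma exists_eq_unit_mul_X_pow_add {f : 𝔖 p k} {d : ℕ}
    (hd : ¬ (p : WittVector p k) ∣ PowerSeries.coeff d f) :
    ∃ e ≤ d, ∃ u' v' : 𝔖 p k, IsUnit u' ∧ f = u' * PowerSeries.X ^ e + (p : 𝔖 p k) * v' := by
  classical
  have hex : ∃ n, ¬ (p : WittVector p k) ∣ PowerSeries.coeff n f := ⟨d, hd⟩
  have hlt : ∀ n < Nat.find hex, (p : WittVector p k) ∣ PowerSeries.coeff n f :=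
    fun n hn => not_not.mp (Nat.find_min hex hn)
  choose! g hg using hlt
  refine ⟨Nat.find hex, Nat.find_min' hex hd,
    PowerSeries.mk fun n => PowerSeries.coeff (n + Nat.find hex) f,
    PowerSeries.mk fun n => if n < Nat.find hex then g n else 0, ?_, ?_⟩
  · rw [PowerSeries.isUnit_iff_constantCoeff, ← PowerSeries.coeff_zero_eq_constantCoeff_apply,
      PowerSeries.coeff_mk, zero_add]
    exact isUnit_of_not_p_dvd (Nat.find_spec hex)
  · ext1 n
    rw [map_add, PowerSeries.coeff_mul_X_pow',
      show (p : 𝔖 p k) = PowerSeries.C (p : WittVector p k) from (map_natCast _ p).symm,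
      PowerSeries.coeff_C_mul, PowerSeries.coeff_mk, PowerSeries.coeff_mk]
    by_cases hn : n < Nat.find hex
    · rw [if_neg (not_le.mpr hn), if_pos hn, zero_add, hg n hn]
    · rw [if_pos (not_lt.mp hn), if_neg hn, mul_zero, add_zero,
        Nat.sub_add_cancel (not_lt.mp hn)]

variable {O : Type v} [CommRing O] [IsDomain O] [IsDiscreteValuationRing O]
  [Algebra (WittVector p k) O] [FaithfulSMul (WittVector p k) O] [Module.Finite (WittVector p k) O]

/-- In a totally ramified extension, `p` generates the ideal `(π ^ e)`. -/
lemma associated_p_pow_ramificationIdx {π : O} (hπ : Irreducible π) :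
    Associated (p : O)
      (π ^ (IsLocalRing.maximalIdeal O).ramificationIdx (WittVector p k)) := by
  have hinj := FaithfulSMul.algebraMap_injective (WittVector p k) O
  have hp0 : (p : O) ≠ 0 := by
    rw [← map_natCast (algebraMap (WittVector p k) O), Ne, map_eq_zero_iff _ hinj]
    exact (WittVector.irreducible p).ne_zero
  have hunder : (IsLocalRing.maximalIdeal O).under (WittVector p k) =
      Ideal.span {(p : WittVector p k)} := by
    rw [← (IsDiscreteValuationRing.irreducible_iff_uniformizer _).mp (WittVector.irreducible p)]
    exact IsLocalRing.eq_maximalIdeal (Ideal.isMaximal_comap_of_isIntegral_of_isMaximal _)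
  have hmap : ((IsLocalRing.maximalIdeal O).under (WittVector p k)).map
      (algebraMap (WittVector p k) O) = Ideal.span {(p : O)} := by
    rw [hunder, Ideal.map_span, Set.image_singleton, map_natCast]
  obtain ⟨n, hn⟩ := IsDiscreteValuationRing.associated_pow_irreducible hp0 hπ
  have hspan : Ideal.span {(p : O)} = IsLocalRing.maximalIdeal O ^ n := by
    rw [(IsDiscreteValuationRing.irreducible_iff_uniformizer _).mp hπ, Ideal.span_singleton_pow,
      Ideal.span_singleton_eq_span_singleton]
    exact hn
  have hne : Ideal.span {(p : O)} ≠ ⊥ := by rwa [Ne, Ideal.span_singleton_eq_bot]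
  rw [Ideal.IsDedekindDomain.ramificationIdx_eq_multiplicity
    ((IsLocalRing.maximalIdeal O).under (WittVector p k)) _ (hmap ▸ hne), hmap, hspan,
    multiplicity_pow_self]
  · exact hn
  · exact IsDiscreteValuationRing.not_a_field O
  · rw [Ideal.isUnit_iff]
    exact (IsLocalRing.maximalIdeal.isMaximal O).ne_top

/-- The powers of a uniformizer below the ramification index generate `O` over `W(k)`. -/
lemma span_pow_lt_ramificationIdx
    (hres : Function.Surjective ((IsLocalRing.residue O).comp (algebraMap (WittVector p k) O)))
    {π : O} (hπ : Irreducible π) :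
    Submodule.span (WittVector p k)
      ((fun i => π ^ i) '' Set.Iio ((IsLocalRing.maximalIdeal O).ramificationIdx (WittVector p k)))
      = ⊤ := by
  set e := (IsLocalRing.maximalIdeal O).ramificationIdx (WittVector p k) with he
  set N := Submodule.span (WittVector p k) ((fun i => π ^ i) '' Set.Iio e) with hN
  -- Digits in `W(k)` are peeled off `π`-adically up to `π ^ e`, which is `p` up to a unit;
  -- Nakayama's lemma over `W(k)` finishes.
  have happrox : ∀ n ≤ e, ∀ x : O, ∃ y ∈ N, ∃ z, x = y + π ^ n * z := by
    intro n
    induction n with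
    | zero => exact fun _ x => ⟨0, N.zero_mem, x, by simp⟩
    | succ n ih =>
      intro hn x
      obtain ⟨y, hy, z, hz⟩ := ih (by omega) x
      obtain ⟨a, ha⟩ := hres (IsLocalRing.residue O z)
      have h1 : z - algebraMap (WittVector p k) O a ∈ IsLocalRing.maximalIdeal O := by
        rw [← IsLocalRing.residue_eq_zero_iff, map_sub, ← ha, RingHom.comp_apply, sub_self]
      rw [(IsDiscreteValuationRing.irreducible_iff_uniformizer _).mp hπ,
        Ideal.mem_span_singleton] at h1
      obtain ⟨t, ht⟩ := h1
      refine ⟨y + a • π ^ n, N.add_mem hy (N.smul_mem _ (Submodule.subset_span ⟨n, ?_, rfl⟩)), t, ?_⟩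
      · exact Set.mem_Iio.mpr (by omega)
      · rw [Algebra.smul_def, hz]
        linear_combination π ^ n * ht
  rw [eq_top_iff]
  refine Submodule.le_of_le_smul_of_le_jacobson_bot (I := Ideal.span {(p : WittVector p k)})
    Module.Finite.fg_top ?_ ?_
  · rw [← (IsDiscreteValuationRing.irreducible_iff_uniformizer _).mp (WittVector.irreducible p)]
    exact IsLocalRing.maximalIdeal_le_jacobson _
  · intro x _
    obtain ⟨y, hy, z, rfl⟩ := happrox e le_rfl x
    obtain ⟨c, hc⟩ := (associated_p_pow_ramificationIdx (p := p) (k := k) hπ).dvd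
    refine Submodule.add_mem_sup hy ?_
    rw [hc, mul_assoc, ← map_natCast (algebraMap (WittVector p k) O), ← Algebra.smul_def]
    exact Submodule.smul_mem_smul (Ideal.mem_span_singleton_self _) trivial

/-- Writing `π ^ e` through lower powers of `π` gives a monic polynomial of degree `e` that kills
`π`. -/
lemma natDegree_minpoly_le_ramificationIdx
    (hres : Function.Surjective ((IsLocalRing.residue O).comp (algebraMap (WittVector p k) O)))
    {π : O} (hπ : Irreducible π) :
    (minpoly (WittVector p k) π).natDegree ≤
      (IsLocalRing.maximalIdeal O).ramificationIdx (WittVector p k) := by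
  set e := (IsLocalRing.maximalIdeal O).ramificationIdx (WittVector p k) with he
  have h1 : π ^ e ∈ Submodule.span (WittVector p k) ((fun i => π ^ i) '' Set.Iio e) := by
    rw [span_pow_lt_ramificationIdx hres hπ]
    trivial
  have h2 : Submodule.span (WittVector p k) ((fun i => π ^ i) '' Set.Iio e) ≤
      (Polynomial.degreeLT (WittVector p k) e).map (Polynomial.aeval π).toLinearMap := by
    rw [Submodule.span_le]
    rintro _ ⟨i, hi, rfl⟩
    refine ⟨Polynomial.X ^ i, ?_, by simp⟩
    rw [SetLike.mem_coe, Polynomial.mem_degreeLT, Polynomial.degree_X_pow]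
    exact_mod_cast hi
  obtain ⟨q, hq, hqπ⟩ := h2 h1
  rw [SetLike.mem_coe, Polynomial.mem_degreeLT] at hq
  have hmonic : (Polynomial.X ^ e - q).Monic := Polynomial.monic_X_pow_sub hq
  have h3 := minpoly.min (WittVector p k) π hmonic (by
    have : Polynomial.aeval π q = π ^ e := hqπ
    simp [this])
  refine (Polynomial.natDegree_le_natDegree h3).trans ?_
  have h4 := Polynomial.natDegree_sub_le_of_le
    (Polynomial.natDegree_X_pow_le (R := WittVector p k) e)
    (Polynomial.natDegree_le_of_degree_le hq.le)
  rwa [max_self] at h4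

/-- The leading coefficient `1` is prime to `p`. Only an upper bound on the exponent is needed,
since a smaller one makes `e * r < p - 1` easier. -/
lemma eisenstein_eq_unit_mul_X_pow_add
    (hres : Function.Surjective ((IsLocalRing.residue O).comp (algebraMap (WittVector p k) O)))
    {π : O} (hπ : Irreducible π) :
    ∃ e ≤ (IsLocalRing.maximalIdeal O).ramificationIdx (WittVector p k), ∃ u' v' : 𝔖 p k,
      IsUnit u' ∧ eisenstein p k π = u' * PowerSeries.X ^ e + (p : 𝔖 p k) * v' := by
  have hmonic := minpoly.monic (Algebra.IsIntegral.isIntegral (R := WittVector p k) π)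
  obtain ⟨e, he, h⟩ := exists_eq_unit_mul_X_pow_add (f := eisenstein p k π)
    (d := (minpoly (WittVector p k) π).natDegree) (by
      rw [eisenstein, Polynomial.coeff_coe, hmonic.coeff_natDegree]
      exact fun h => (WittVector.irreducible p).not_isUnit (isUnit_of_dvd_one h))
  exact ⟨e, he.trans (natDegree_minpoly_le_ramificationIdx hres hπ), h⟩

end Eisenstein

/-! ### Elements of the pullback `σ^*M` -/

section PullbackElements

variable {R : Type u} [CommRing R] (σ : R →+* R) {M : Type v} [AddCommGroup M] [Module R M]

/-- The element `1 ⊗ m` of `σ^*M`. -/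
def Pullback.of (m : M) : Pullback σ M := (1 : Twist σ) ⊗ₜ[R] m

lemma Pullback.of_add (m n : M) : Pullback.of σ (m + n) = Pullback.of σ m + Pullback.of σ n :=
  TensorProduct.tmul_add _ _ _

lemma Pullback.of_smul (a : R) (m : M) : Pullback.of σ (a • m) = σ a • Pullback.of σ m := by
  have h1 : Pullback.of σ (a • m) = ((a • (1 : Twist σ)) ⊗ₜ[R] m : Twist σ ⊗[R] M) :=
    (TensorProduct.smul_tmul a (1 : Twist σ) m).symm
  have h2 : σ a • Pullback.of σ m =
      (((algebraMap R (Twist σ) a) • (1 : Twist σ)) ⊗ₜ[R] m : Twist σ ⊗[R] M) :=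
    TensorProduct.smul_tmul' (algebraMap R (Twist σ) a) (1 : Twist σ) m
  rw [h1, h2, Algebra.smul_def, smul_eq_mul]

lemma Pullback.map_of {N : Type w} [AddCommGroup N] [Module R N] (f : M →ₗ[R] N) (m : M) :
    Pullback.map σ f (Pullback.of σ m) = Pullback.of σ (f m) :=
  LinearMap.baseChange_tmul _ _ _

lemma Pullback.span_range_of :
    Submodule.span R (Set.range (Pullback.of σ (M := M))) = ⊤ := by
  rw [eq_top_iff]
  intro x _
  refine TensorProduct.induction_on (R := R) (M := Twist σ) (N := M)
    (motive := fun x => (x : Pullback σ M) ∈ Submodule.span R (Set.range (Pullback.of σ (M := M))))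
    x (Submodule.zero_mem _) (fun s m => ?_) fun x y hx hy => Submodule.add_mem _ hx hy
  have h : (s ⊗ₜ[R] m : Twist σ ⊗[R] M) = s • ((1 : Twist σ) ⊗ₜ[R] m) := by
    rw [TensorProduct.smul_tmul', smul_eq_mul, mul_one]
  rw [h]
  let s' : R := s
  change s' • Pullback.of σ m ∈ _
  exact Submodule.smul_mem _ s' (Submodule.subset_span ⟨m, rfl⟩)

/-- A linear map `ℓ : M → R / c` induces `σ^*M → R / c` if `σ c = c`; on sums of `a i ⊗ m i`
it is computed through representatives `s i` of `ℓ (m i)`. -/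
lemma Pullback.dvd_of_sum_smul_of_eq_zero {c : R} (hc : σ c = c)
    (ℓ : M →ₗ[R] R ⧸ Ideal.span {c}) {ι : Type*} (t : Finset ι) (a s : ι → R) (m : ι → M)
    (hs : ∀ i, ℓ (m i) = Ideal.Quotient.mk _ (s i))
    (h : ∑ i ∈ t, a i • Pullback.of σ (m i) = 0) : c ∣ ∑ i ∈ t, a i * σ (s i) := by
  let I : Ideal (Twist σ) := Ideal.span {(c : Twist σ)}
  let lam : (R ⧸ Ideal.span {c}) →ₗ[R] (Twist σ ⧸ I) :=
    (Ideal.span {c}).liftQ (Algebra.linearMap R (Twist σ ⧸ I)) (by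
      rw [Ideal.span, Submodule.span_singleton_le_iff_mem, LinearMap.mem_ker]
      refine Ideal.Quotient.eq_zero_iff_mem.mpr ?_
      change σ c ∈ I
      rw [hc]
      exact Ideal.mem_span_singleton_self _)
  let L : Twist σ ⊗[R] M →ₗ[Twist σ] (Twist σ ⧸ I) := (lam ∘ₗ ℓ).liftBaseChange (Twist σ)
  let tw : R → Twist σ := id
  have hL : ∀ i, L (tw (a i) • ((1 : Twist σ) ⊗ₜ[R] m i)) =
      Ideal.Quotient.mk I (tw (a i * σ (s i))) := by
    intro i
    rw [map_smul, LinearMap.liftBaseChange_tmul, one_smul, LinearMap.comp_apply, hs]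
    rfl
  have h1 : ∑ i ∈ t, tw (a i) • ((1 : Twist σ) ⊗ₜ[R] m i) = 0 := h
  have h2 : Ideal.Quotient.mk I (∑ i ∈ t, tw (a i * σ (s i))) = 0 := by
    rw [map_sum, ← Finset.sum_congr rfl fun i _ => hL i, ← map_sum, h1, map_zero]
  exact Ideal.mem_span_singleton.mp (Ideal.Quotient.eq_zero_iff_mem.mp h2)

end PullbackElements

/-! ### Divisibility by integers in `𝔖`, with `c = p` and `c = 0` treated alike -/

section Divisibility

variable {p : ℕ} [Fact p.Prime] {k : Type u} [Field k]

lemma natCast_dvd_iff_coeff {c : ℕ} {s : 𝔖 p k} :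
    (c : 𝔖 p k) ∣ s ↔ ∀ n, (c : WittVector p k) ∣ PowerSeries.coeff n s := by
  rw [show (c : 𝔖 p k) = PowerSeries.C (c : WittVector p k) from (map_natCast _ c).symm]
  constructor
  · rintro ⟨t, rfl⟩ n
    exact ⟨PowerSeries.coeff n t, PowerSeries.coeff_C_mul _ _ _⟩
  · intro h
    choose g hg using h
    refine ⟨PowerSeries.mk g, ?_⟩
    ext1 n
    rw [PowerSeries.coeff_C_mul, PowerSeries.coeff_mk, hg]

lemma natCast_dvd_of_dvd_X_pow_mul {c : ℕ} {s : 𝔖 p k} {e : ℕ}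
    (h : (c : 𝔖 p k) ∣ PowerSeries.X ^ e * s) : (c : 𝔖 p k) ∣ s := by
  rw [natCast_dvd_iff_coeff] at h ⊢
  intro n
  rw [← PowerSeries.coeff_X_pow_mul]
  exact h _

/-- The summands occupy disjoint residue classes of exponents modulo `p`, and the Frobenius of
`W(k)` is bijective and fixes `c`. -/
lemma natCast_dvd_of_dvd_sum [CharP k p] [PerfectRing k p] {c : ℕ} {s : ℕ → 𝔖 p k}
    (h : (c : 𝔖 p k) ∣ ∑ i ∈ Finset.range p, PowerSeries.X ^ i * frob p k (s i)) {i : ℕ}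
    (hi : i < p) : (c : 𝔖 p k) ∣ s i := by
  rw [natCast_dvd_iff_coeff] at h ⊢
  intro n
  obtain ⟨b, hb⟩ := h (p * n + i)
  rw [coeff_sum_X_pow_mul_frob s n i hi] at hb
  obtain ⟨b, rfl⟩ := (WittVector.frobenius_bijective p k).surjective b
  refine ⟨b, (WittVector.frobenius_bijective p k).injective ?_⟩
  rw [hb, map_mul, map_natCast]

variable {E u' v' : 𝔖 p k} {e : ℕ}

lemma p_dvd_of_dvd_mul (hu : IsUnit u')
    (hE : E = u' * PowerSeries.X ^ e + (p : 𝔖 p k) * v') {s : 𝔖 p k} (h : (p : 𝔖 p k) ∣ E * s) : (p : 𝔖 p k) ∣ s := by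
  refine natCast_dvd_of_dvd_X_pow_mul (e := e) (hu.dvd_mul_left.mp ?_)
  rw [show u' * (PowerSeries.X ^ e * s) = E * s - (p : 𝔖 p k) * (v' * s) by rw [hE]; ring]
  exact dvd_sub h (dvd_mul_right _ _)

lemma zero_dvd_of_dvd_mul [CharP k p] [PerfectRing k p] (hu : IsUnit u')
    (hE : E = u' * PowerSeries.X ^ e + (p : 𝔖 p k) * v') {s : 𝔖 p k}
    (h : ((0 : ℕ) : 𝔖 p k) ∣ E * s) : ((0 : ℕ) : 𝔖 p k) ∣ s := by
  rw [Nat.cast_zero, zero_dvd_iff] at h ⊢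
  refine (mul_eq_zero.mp h).resolve_left fun h0 => ?_
  have h1 := p_dvd_of_dvd_mul (s := 1) hu hE (by rw [h0, zero_mul]; exact dvd_zero _)
  have h2 := natCast_dvd_iff_coeff.mp h1 0
  rw [PowerSeries.coeff_zero_one] at h2
  exact (WittVector.irreducible p).not_isUnit (isUnit_of_dvd_one h2)

end Divisibility

/-! ### Breuil–Kisin modules as maximal lattices -/

namespace BKModule

variable {p : ℕ} [Fact p.Prime] {k : Type u} [Field k] {E : 𝔖 p k}

/-- The localization map `M → M[1/E]`. -/
abbrev toInv (E : 𝔖 p k) (M : Type w) [AddCommGroup M] [Module (𝔖 p k) M] :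
    M →ₗ[𝔖 p k] Inv E M :=
  LocalizedModule.mkLinearMap (Submonoid.powers E) M

lemma exists_pow_smul_eq_zero {M : Type w} [AddCommGroup M] [Module (𝔖 p k) M] {x : M}
    (hx : toInv E M x = 0) : ∃ n : ℕ, E ^ n • x = 0 := by
  obtain ⟨⟨_, n, rfl⟩, hc⟩ :=
    (IsLocalizedModule.eq_zero_iff (Submonoid.powers E) (toInv E M)).mp hx
  exact ⟨n, hc⟩

lemma toInv_injective {M : Type w} [AddCommGroup M] [Module (𝔖 p k) M]
    (hM : ∀ m : M, E • m = 0 → m = 0) : Function.Injective (toInv E M) := by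
  rw [injective_iff_map_eq_zero]
  intro m hm
  obtain ⟨n, hn⟩ := exists_pow_smul_eq_zero hm
  induction n with
  | zero => simpa using hn
  | succ n ih =>
    rw [pow_succ', mul_smul] at hn
    exact ih (hM _ hn)

/-- The semilinear map `F` induces the Frobenius structure: `Φ (1 ⊗ m) = F m`. -/
def IsFrob (M : BKModule.{u, w} E) (F : M.carrier →ₛₗ[frob p k] M.carrier) : Prop :=
  ∀ m, M.Φ (toInv E _ (Pullback.of (frob p k) m)) = toInv E _ (F m)

/-- Without `E`-torsion `M` embeds in `M[1/E]`, so `Φ (1 ⊗ m)` has a unique preimage in `M`, and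
uniqueness makes the choice semilinear. -/
lemma exists_isFrob (M : BKModule.{u, w} E) (hM : ∀ m : M.carrier, E • m = 0 → m = 0)
    (h : M.image ≤ M.lattice 0) : ∃ F, IsFrob M F := by
  have h1 : ∀ m, ∃ y, M.Φ (toInv E _ (Pullback.of (frob p k) m)) = toInv E _ y := by
    intro m
    obtain ⟨y, hy⟩ := h ⟨Pullback.of (frob p k) m, rfl⟩
    refine ⟨y, ?_⟩
    rw [pow_zero, one_smul] at hy
    exact hy.symm
  choose F hF using h1
  refine ⟨{ toFun := F, map_add' := fun x y => ?_, map_smul' := fun s x => ?_ }, hF⟩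
  · refine toInv_injective hM ?_
    rw [map_add, ← hF, ← hF, ← hF, Pullback.of_add, map_add, map_add]
  · refine toInv_injective hM ?_
    rw [map_smul, ← hF, ← hF, Pullback.of_smul, map_smul, map_smul]

lemma IsFrob.mem_frobSpan {M : BKModule.{u, w} E} {F : M.carrier →ₛₗ[frob p k] M.carrier}
    (hF : IsFrob M F) (hM : ∀ m : M.carrier, E • m = 0 → m = 0) {r : ℕ}
    (h : M.lattice r ≤ M.image) (m : M.carrier) : E ^ r • m ∈ frobSpan F ⊤ := by
  obtain ⟨x, hx⟩ := h ⟨m, rfl⟩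
  have hle : (⊤ : Submodule (𝔖 p k) (Pullback (frob p k) M.carrier)) ≤
      ((frobSpan F ⊤).map (toInv E M.carrier)).comap
        (M.Φ.toLinearMap ∘ₗ toInv E (Pullback (frob p k) M.carrier)) := by
    rw [← Pullback.span_range_of, Submodule.span_le]
    rintro _ ⟨y, rfl⟩
    exact ⟨F y, Submodule.subset_span ⟨y, trivial, rfl⟩, (hF y).symm⟩
  obtain ⟨y, hy, hyx⟩ := hle (x := x) trivial
  have : y = E ^ r • m := by
    refine toInv_injective hM ?_
    rw [map_smul]
    exact hyx.trans hx
  exact this ▸ hy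

lemma IsFrob.map_eq {A B : BKModule.{u, w} E} {FA : A.carrier →ₛₗ[frob p k] A.carrier}
    {FB : B.carrier →ₛₗ[frob p k] B.carrier} (hA : IsFrob A FA) (hB : IsFrob B FB)
    (hEB : ∀ m : B.carrier, E • m = 0 → m = 0) (f : Hom A B) (a : A.carrier) :
    f.toLinearMap (FA a) = FB (f.toLinearMap a) := by
  refine toInv_injective hEB ?_
  have h := f.comm (toInv E _ (Pullback.of (frob p k) a))
  rw [hA, Inv.map, Inv.map, IsLocalizedModule.map_apply, IsLocalizedModule.map_apply,
    Pullback.map_of, hB] at h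
  exact h.symm

/-- The linearization of Frobenius is injective on modules that are free over `𝔖 / c`. -/
lemma IsFrob.linearizationInjective [CharP k p] [PerfectRing k p] {M : BKModule.{u, w} E}
    {F : M.carrier →ₛₗ[frob p k] M.carrier} (hF : IsFrob M F) {c : ℕ}
    (hcE : ∀ s, (c : 𝔖 p k) ∣ E * s → (c : 𝔖 p k) ∣ s) {n : ℕ}
    (ψ : M.carrier ≃ₗ[𝔖 p k] (Fin n → 𝔖 p k ⧸ Ideal.span {(c : 𝔖 p k)})) :
    LinearizationInjective F := by
  have hcEn : ∀ (l : ℕ) (s : 𝔖 p k), (c : 𝔖 p k) ∣ E ^ l * s → (c : 𝔖 p k) ∣ s := by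
    intro l
    induction l with
    | zero => simp
    | succ l ih =>
      intro s hs
      rw [pow_succ', mul_assoc] at hs
      exact ih s (hcE _ hs)
  intro m hm i hi
  have h1 : toInv E _ (∑ i ∈ Finset.range p,
      (PowerSeries.X : 𝔖 p k) ^ i • Pullback.of (frob p k) (m i)) = 0 := by
    rw [← M.Φ.map_eq_zero_iff, map_sum, map_sum, ← map_zero (toInv E M.carrier), ← hm, map_sum]
    refine Finset.sum_congr rfl fun j _ => ?_
    rw [map_smul, map_smul, hF, map_smul]
  -- Injectivity of `Φ` gives vanishing only after inverting `E`; the factor `E ^ l` is cancelled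
  -- coordinatewise through `hcE`.
  obtain ⟨l, hl⟩ := exists_pow_smul_eq_zero h1
  refine ψ.map_eq_zero_iff.mp (funext fun j => ?_)
  choose s hs using fun i => Ideal.Quotient.mk_surjective (ψ (m i) j)
  have h2 := Pullback.dvd_of_sum_smul_of_eq_zero (frob p k) (map_natCast _ c)
    (LinearMap.proj j ∘ₗ ψ.toLinearMap) (Finset.range p)
    (fun i => E ^ l * (PowerSeries.X : 𝔖 p k) ^ i) s m (fun i => (hs i).symm) (by
      rw [← hl, Finset.smul_sum]
      exact Finset.sum_congr rfl fun i _ => mul_smul _ _ _)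
  simp only [mul_assoc, ← Finset.mul_sum] at h2
  rw [← hs i]
  exact Ideal.Quotient.eq_zero_iff_mem.mpr
    (Ideal.mem_span_singleton.mpr (natCast_dvd_of_dvd_sum (hcEn l _ h2) hi))

/-- Torsion-freeness of modules that are free over `𝔖 / c`. -/
lemma eq_zero_of_smul_eq_zero_of_equiv {M : Type w} [AddCommGroup M] [Module (𝔖 p k) M] {c : ℕ}
    {a : 𝔖 p k} (hca : ∀ s, (c : 𝔖 p k) ∣ a * s → (c : 𝔖 p k) ∣ s) {n : ℕ}
    (ψ : M ≃ₗ[𝔖 p k] (Fin n → 𝔖 p k ⧸ Ideal.span {(c : 𝔖 p k)})) {m : M} (h : a • m = 0) :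
    m = 0 := by
  refine ψ.map_eq_zero_iff.mp (funext fun j => ?_)
  obtain ⟨s, hs⟩ := Ideal.Quotient.mk_surjective (ψ m j)
  have h1 : a • ψ m j = 0 := by
    rw [← Pi.smul_apply, ← map_smul, h, map_zero, Pi.zero_apply]
  rw [← hs] at h1 ⊢
  exact Ideal.Quotient.eq_zero_iff_mem.mpr (Ideal.mem_span_singleton.mpr
    (hca s (Ideal.mem_span_singleton.mp (Ideal.Quotient.eq_zero_iff_mem.mp h1))))

lemma eq_zero_of_smul_eq_zero_of_exact {A B C : Type w}
    [AddCommGroup A] [Module (𝔖 p k) A] [AddCommGroup B] [Module (𝔖 p k) B]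
    [AddCommGroup C] [Module (𝔖 p k) C] {f : A →ₗ[𝔖 p k] B} {g : B →ₗ[𝔖 p k] C}
    (hf : Function.Injective f) (hfg : Function.Exact f g) {a : 𝔖 p k}
    (hA : ∀ x : A, a • x = 0 → x = 0) (hC : ∀ x : C, a • x = 0 → x = 0) (x : B)
    (hx : a • x = 0) : x = 0 := by
  obtain ⟨y, rfl⟩ := (hfg x).mp (hC _ (by rw [← map_smul, hx, map_zero]))
  rw [hA y (hf (by rw [map_smul, hx, map_zero])), map_zero]

/-- The properties of a Breuil--Kisin module that determine the structure of its underlying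
module and pass to extensions. -/
structure IsMaximalLattice (M : BKModule.{u, w} E) : Prop where
  E_torsion_free : ∀ m : M.carrier, E • m = 0 → m = 0
  X_torsion_free : ∀ m : M.carrier, (PowerSeries.X : 𝔖 p k) • m = 0 → m = 0
  exists_frob : ∃ F, IsFrob M F ∧ LinearizationInjective F ∧ LatticeMaximal F

variable [CharP k p] [PerfectRing k p] {u' v' : 𝔖 p k} {e r : ℕ}

lemma IsMaximalLattice.of_equiv (hu : IsUnit u')
    (hE : E = u' * PowerSeries.X ^ e + (p : 𝔖 p k) * v') (her : e * r < p - 1)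
    {M : BKModule.{u, w} E} (hM : ModHeight r M) {c : ℕ}
    (hcE : ∀ s, (c : 𝔖 p k) ∣ E * s → (c : 𝔖 p k) ∣ s) {n : ℕ}
    (ψ : M.carrier ≃ₗ[𝔖 p k] (Fin n → 𝔖 p k ⧸ Ideal.span {(c : 𝔖 p k)})) :
    IsMaximalLattice M := by
  have hEM : ∀ m : M.carrier, E • m = 0 → m = 0 :=
    fun m => eq_zero_of_smul_eq_zero_of_equiv hcE ψ
  obtain ⟨F, hF⟩ := exists_isFrob M hEM hM.2
  exact ⟨hEM, fun m => eq_zero_of_smul_eq_zero_of_equiv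
    (fun s hs => natCast_dvd_of_dvd_X_pow_mul (e := 1) (by rwa [pow_one])) ψ,
    F, hF, hF.linearizationInjective hcE ψ,
    latticeMaximal_of_height hu hE her F (hF.mem_frobSpan hEM hM.1)⟩

lemma IsMaximalLattice.of_modBarOne (hu : IsUnit u')
    (hE : E = u' * PowerSeries.X ^ e + (p : 𝔖 p k) * v') (her : e * r < p - 1)
    {M : BKModule.{u, w} E} (hM : ModBarOne r M) : IsMaximalLattice M := by
  obtain ⟨hr, ⟨n, ⟨ψ⟩⟩ | ⟨n, ⟨ψ⟩⟩⟩ := hM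
  · exact of_equiv hu hE her hr (fun s => p_dvd_of_dvd_mul hu hE) ψ
  -- Free modules over `𝔖` are the case `c = 0`, through `𝔖 ≃ 𝔖 / 0`.
  · exact of_equiv hu hE her hr (fun s => zero_dvd_of_dvd_mul hu hE)
      (ψ.trans (LinearEquiv.piCongrRight fun _ =>
        (Submodule.quotEquivOfEqBot (Ideal.span {((0 : ℕ) : 𝔖 p k)}) (by simp)).symm))

lemma IsMaximalLattice.of_modBarInfty (hu : IsUnit u')
    (hE : E = u' * PowerSeries.X ^ e + (p : 𝔖 p k) * v') (her : e * r < p - 1)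
    {M : BKModule.{u, w} E} (hM : ModBarInfty r M) : IsMaximalLattice M := by
  induction hM with
  | base M hM => exact of_modBarOne hu hE her hM
  | ext A B C hA hB hC f g hf hfg hg _ _ ihA ihC =>
    have hEB := eq_zero_of_smul_eq_zero_of_exact hf hfg ihA.E_torsion_free ihC.E_torsion_free
    obtain ⟨FA, hFA, hAinj, hAmax⟩ := ihA.exists_frob
    obtain ⟨FC, hFC, hCinj, hCmax⟩ := ihC.exists_frob
    obtain ⟨_, _, hB⟩ := hB
    -- For the members of an extension only some finite height is known. That suffices, since `l` is
    -- not subject to the bound on `e * r`.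
    obtain ⟨l, _, hA⟩ := hA
    obtain ⟨FB, hFB⟩ := exists_isFrob B hEB hB.2
    have hfF := hFA.map_eq hFB hEB f
    have hgF := hFB.map_eq hFC ihC.E_torsion_free g
    exact ⟨hEB, eq_zero_of_smul_eq_zero_of_exact hf hfg ihA.X_torsion_free ihC.X_torsion_free,
      FB, hFB, hAinj.of_exact hf hfg hfF hgF hCinj,
      hAmax.of_exact hu hE hf hfg hg hfF hgF hCinj
        (hFA.mem_frobSpan ihA.E_torsion_free hA.1) hCmax⟩

lemma IsMaximalLattice.hasFIForm {M : BKModule.{u, w} E} (hM : IsMaximalLattice M) :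
    HasFIForm M := by
  obtain ⟨F, -, hinj, hmax⟩ := hM.exists_frob
  exact exists_equiv_of_torsion_free hM.X_torsion_free
    fun i _ _ h => hmax.exists_eq_p_pow_smul hinj i h

end BKModule

end BK

end

theorem mainTheorem8 (p : ℕ) [Fact p.Prime]
    -- a perfect field `k` of characteristic `p`
    (k : Type u) [Field k] [CharP k p] [PerfectRing k p]
    -- the ring of integers `O` of a finite totally ramified extension of `Frac W(k)`:
    -- a discrete valuation ring, finite over `W(k)`, with residue field `k`
    (O : Type v) [CommRing O] [IsDomain O] [IsDiscreteValuationRing O]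
    [Algebra (WittVector p k) O] [FaithfulSMul (WittVector p k) O] [Module.Finite (WittVector p k) O]
    (hres : Function.Surjective
      ((IsLocalRing.residue O).comp (algebraMap (WittVector p k) O)))
    -- a uniformizer
    (π : O) (hπ : Irreducible π)
    (r : ℕ)
    (her : (IsLocalRing.maximalIdeal O).ramificationIdx (WittVector p k) * r < p - 1) :
    (∀ M : BK.BKModule.{u, w} (BK.eisenstein p k π),
      BK.BKModule.ModFIBarInfty r M ↔ BK.BKModule.ModBarInfty r M) ∧
    (∀ M : BK.BKModule.{u, w} (BK.eisenstein p k π), BK.BKModule.ModBarInfty r M →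
      ∃ (m n : ℕ) (a : Fin n → ℕ), (∀ i, 1 ≤ a i) ∧
        Nonempty (M.carrier ≃ₗ[BK.𝔖 p k]
          ((Fin m → BK.𝔖 p k) ×
            ((i : Fin n) → BK.𝔖 p k ⧸ Ideal.span {(p : BK.𝔖 p k) ^ a i})))) := by
  obtain ⟨e, he, u', v', hu, hE⟩ := BK.eisenstein_eq_unit_mul_X_pow_add hres hπ
  have key : ∀ M : BK.BKModule.{u, w} (BK.eisenstein p k π), BK.BKModule.ModBarInfty r M →
      BK.BKModule.HasFIForm M := fun M hM =>
    (BK.BKModule.IsMaximalLattice.of_modBarInfty hu hE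
      ((Nat.mul_le_mul_right r he).trans_lt her) hM).hasFIForm
  exact ⟨fun M => ⟨fun h => h.1, fun h => ⟨h, key M h⟩⟩, key⟩
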